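/- **Setting.** Let $\mathbb K$ be a field, $n\ge 0$, and let $\beta_{i,j}\in\mathbb K^*$ for $1\le i<j\le n$. Let $\mathfrak A$ be the $\mathbb K$-algebra generated by $e_1,\dots,e_n$ subject to the relations $e_i^2=0$ and $e_je_i=\beta_{i,j}e_ie_j$ for $i<j$. For $X=\{i_1<\dots<i_m\}\subseteq[n]$ put $e_X=e_{i_1}\cdots e_{i_m}$ ($e_\emptyset=1$); these monomials form a $\mathbb K$-basis of $\mathfrak A$. Let $\mathcal M$ be a loop-free matroid on $[n]$ with closure operator $\mathrm{cl}$, and let $\chi:2^{[n]}\to\mathbb K$. The $\chi$-boundary of $e_X$ is $$\partial e_X=\sum_{p=1}^{m}(-1)^p\chi(X\setminus i_p)\,e_{X\setminus i_p}\quad(m\ge2),\qquad \partial e_i=1.$$ Call $U\subseteq[n]$ unidependent if it contains exactly one circuit of $\mathcal M$. Assume that $\mathfrak A/\mathfrak I_\chi(\mathcal M)$ is a $\chi$-algebra, that is: (i) $\chi(I)\ne0$ if and only if $I$ is independent; (ii) for all unidependent $U'\subseteq U$ there is $\varepsilon\in\mathbb K^*$ with $\partial e_U=\varepsilon\,(\partial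 e_{U'})\,e_{U\setminus U'}$. Here the $\chi$-ideal $\mathfrak I_\chi(\mathcal M)$ is the right ideal of $\mathfrak A$ generated by the $\partial e_C$ with $C$ a circuit, $|C|>1$ (and by the $e_i$ with $i$ a loop). Let $\mathbb K[\mathbb T_i]$ be the span of the $e_I$ with $I$ independent, $p_i:\mathfrak A\to\mathbb K[\mathbb T_i]$ the projection that kills the monomials of dependent sets, and $f\star g=p_i(fg)$ the product of $\mathbb K[\mathbb T_i]$; put $\mathfrak I_{\chi_i}(\mathcal M)=p_i(\mathfrak I_\chi(\mathcal M))$, an ideal of $(\mathbb K[\mathbb T_i],\star)$. A term order $\prec$ is a total order on the monomials $e_X$ with least element $1$ such that $e_X\prec e_Y$ implies $e_{X\cup Z}\prec e_{Y\cup Z}$ whenever $e_Xe_Z\ne0$ and $e_Ye_Z\ne0$ (i.e. $X\cap Z=Y\cap Z=\emptyset$). A set $G$ of nonzero elements of an ideal $J$ is a Gröbner basis of $J$ if the leading monomials of the elements of $G$ generate the same ideal as those of the nonzero elements of $J$. It is reduced if moreover all its elements have leading coefficient $1$ and no term of an element $g'\in G$ is divisible by the leading monomial of another element $g\in G$. Let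 $\prec$ be a term order and $\pi$ the permutation of $[n]$ compatible with it: $e_i\prec e_j\iff i<_\pi j$, where $i<_\pi j$ means $\pi^{-1}(i)<\pi^{-1}(j)$. Let $\mathcal P_\pi$ be the set of circuits $C$ whose $<_\pi$-least element $\alpha_\pi(C)$ is also the $<_\pi$-least element of $\mathrm{cl}(C\setminus\alpha_\pi(C))\setminus(C\setminus\alpha_\pi(C))$, and let $\mathfrak C_\pi$ be the set of those $C\in\mathcal P_\pi$ for which $C\setminus\alpha_\pi(C)$ is inclusion-minimal among the sets $C'\setminus\alpha_\pi(C')$, $C'\in\mathcal P_\pi$. **Theorem.** The family $\mathcal G_r=\{\partial e_C: C\in\mathfrak C_\pi\}$ is a Gröbner basis with respect to $\prec$ both of the ideal $\mathfrak I_\chi(\mathcal M)$ of $\mathfrak A$ and of the ideal $\mathfrak I_{\chi_i}(\mathcal M)$ of $\mathbb K[\mathbb T_i]$. After each of its elements is divided by its leading coefficient, it is a reduced Gröbner basis of both ideals, and it is the only reduced Gröbner basis of $\mathfrak I_\chi(\mathcal M)$ with respect to $\prec$. -/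

import Mathlib

noncomputable section

namespace ChiAlg

/-- The structure constant in `e_i e_X = (∏_{j ∈ X, j < i} β_{j,i}) e_{X ∪ i}`. -/
def mvCoeff {K : Type*} [Field K] {n : ℕ} (β : Fin n → Fin n → Kˣ)
    (i : Fin n) (X : Finset (Fin n)) : K :=
  ∏ j ∈ X with j < i, (β j i : K)

/-- The defining relations `e_i ^ 2 = 0` and `e_j e_i = β_{i,j} e_i e_j` for `i < j`.
Only the values `β i j` with `i < j` are used. -/
inductive Rel {K : Type*} [Field K] {n : ℕ} (β : Fin n → Fin n → Kˣ) :
    FreeAlgebra K (Fin n) → FreeAlgebra K (Fin n) → Prop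
  | sq (i : Fin n) : Rel β (FreeAlgebra.ι K i * FreeAlgebra.ι K i) 0
  | swap (i j : Fin n) (h : i < j) :
      Rel β (FreeAlgebra.ι K j * FreeAlgebra.ι K i)
        ((β i j : K) • (FreeAlgebra.ι K i * FreeAlgebra.ι K j))

/-- The `K`-algebra generated by `e_1, …, e_n` subject to the relations `Rel β`. -/
abbrev Alg {K : Type*} [Field K] {n : ℕ} (β : Fin n → Fin n → Kˣ) : Type _ :=
  RingQuot (Rel β)

section Basis

variable {K : Type*} [Field K] {n : ℕ} (β : Fin n → Fin n → Kˣ)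

/-- The generator `e_i`. -/
def gen (i : Fin n) : Alg β := RingQuot.mkAlgHom K (Rel β) (FreeAlgebra.ι K i)

/-- The monomial `e_X = e_{i_1} ⋯ e_{i_m}` for `X = {i_1 < ⋯ < i_m}`; `e_∅ = 1`. -/
def mon (X : Finset (Fin n)) : Alg β := ((X.sort (· ≤ ·)).map (gen β)).prod

theorem gen_sq (i : Fin n) : gen β i * gen β i = 0 := by
  have := RingQuot.mkAlgHom_rel K (Rel.sq (β := β) i)
  simpa [gen] using this

theorem gen_swap {i j : Fin n} (h : i < j) :
    gen β j * gen β i = (β i j : K) • (gen β i * gen β j) := by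
  have := RingQuot.mkAlgHom_rel K (Rel.swap (β := β) i j h)
  simpa [gen] using this

theorem mon_empty : mon β ∅ = 1 := by simp [mon]

theorem sort_insert_of_lt {i : Fin n} {X : Finset (Fin n)} (h : ∀ j ∈ X, i < j) :
    (insert i X).sort (· ≤ ·) = i :: X.sort (· ≤ ·) := by
  refine Finset.sort_insert (r := (· ≤ ·)) (fun j hj => (h j hj).le) (fun hi => ?_)
  exact lt_irrefl _ (h i hi)

theorem mon_insert_of_lt {i : Fin n} {X : Finset (Fin n)} (h : ∀ j ∈ X, i < j) :
    mon β (insert i X) = gen β i * mon β X := by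
  simp [mon, sort_insert_of_lt h]

theorem gen_mul_mon (i : Fin n) (X : Finset (Fin n)) :
    gen β i * mon β X = if i ∈ X then 0 else mvCoeff β i X • mon β (insert i X) := by
  induction X using Finset.induction_on_min with
  | empty =>
    rw [mon_insert_of_lt β (by simp)]
    simp [mvCoeff]
  | insert a X hX ih =>
    have haX : a ∉ X := fun h => lt_irrefl _ (hX a h)
    rw [mon_insert_of_lt β hX, ← mul_assoc]
    rcases lt_trichotomy i a with hia | rfl | hai
    · have hlt : ∀ j ∈ insert a X, i < j := by
        intro j hj
        rcases Finset.mem_insert.1 hj with rfl | hj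
        · exact hia
        · exact hia.trans (hX j hj)
      have hi : i ∉ insert a X := fun h => lt_irrefl _ (hlt i h)
      have hc : mvCoeff β i (insert a X) = 1 := by
        unfold mvCoeff
        rw [Finset.filter_false_of_mem (fun j hj => (hlt j hj).le.not_gt)]
        simp
      rw [if_neg hi, hc, one_smul, mon_insert_of_lt β hlt, mon_insert_of_lt β hX, mul_assoc]
    · simp [gen_sq]
    · rw [gen_swap β hai, smul_mul_assoc, mul_assoc, ih]
      by_cases hi : i ∈ X
      · simp [hi]
      · have hi' : i ∉ insert a X := by simp [hi, hai.ne']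
        rw [if_neg hi, if_neg hi', mul_smul_comm, Finset.insert_comm,
          mon_insert_of_lt β (X := insert i X), smul_smul]
        · congr 1
          unfold mvCoeff
          rw [Finset.filter_insert, if_pos hai, Finset.prod_insert (by simp [haX])]
        · intro j hj
          rcases Finset.mem_insert.1 hj with rfl | hj
          · exact hai
          · exact hX j hj

/-- The operator of left multiplication by `e_i` on the free module on all subsets. -/
def leftOp (i : Fin n) : (Finset (Fin n) →₀ K) →ₗ[K] (Finset (Fin n) →₀ K) :=
  Finsupp.linearCombination K fun X =>
    if i ∈ X then 0 else Finsupp.single (insert i X) (mvCoeff β i X)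

theorem leftOp_single (i : Fin n) (X : Finset (Fin n)) (c : K) :
    leftOp β i (Finsupp.single X c) =
      (if i ∈ X then 0 else Finsupp.single (insert i X) (c * mvCoeff β i X) :
        Finset (Fin n) →₀ K) := by
  unfold leftOp
  rw [Finsupp.linearCombination_single]
  split_ifs <;> simp

theorem leftOp_sq (i : Fin n) : leftOp β i * leftOp β i = 0 := by
  refine Finsupp.lhom_ext fun X c => ?_
  rw [Module.End.mul_apply, leftOp_single]
  split_ifs with h
  · simp
  · rw [leftOp_single, if_pos (Finset.mem_insert_self _ _)]
    rfl

theorem leftOp_swap {i j : Fin n} (h : i < j) :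
    leftOp β j * leftOp β i = (β i j : K) • (leftOp β i * leftOp β j) := by
  refine Finsupp.lhom_ext fun X c => ?_
  rw [LinearMap.smul_apply, Module.End.mul_apply, Module.End.mul_apply, leftOp_single,
    leftOp_single]
  by_cases hi : i ∈ X <;> by_cases hj : j ∈ X
  · simp [hi, hj]
  · rw [if_pos hi, if_neg hj, leftOp_single, if_pos (Finset.mem_insert_of_mem hi)]
    simp
  · rw [if_neg hi, if_pos hj, leftOp_single, if_pos (Finset.mem_insert_of_mem hj)]
    simp
  · have h1 : mvCoeff β j (insert i X) = β i j * mvCoeff β j X := by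
      unfold mvCoeff
      rw [Finset.filter_insert, if_pos h, Finset.prod_insert (by simp [hi])]
    have h2 : mvCoeff β i (insert j X) = mvCoeff β i X := by
      unfold mvCoeff
      rw [Finset.filter_insert, if_neg h.le.not_gt]
    rw [if_neg hi, if_neg hj, leftOp_single, leftOp_single,
      if_neg (by simp [hj, h.ne']), if_neg (by simp [hi, h.ne]), h1, h2,
      Finsupp.smul_single, Finset.insert_comm]
    congr 1
    simp only [smul_eq_mul]
    ring

/-- The representation of the algebra by the operators `leftOp`. -/
def rep : Alg β →ₐ[K] Module.End K (Finset (Fin n) →₀ K) :=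
  RingQuot.liftAlgHom K ⟨FreeAlgebra.lift K (leftOp β), by
    intro x y h
    cases h with
    | sq i => simp [leftOp_sq]
    | swap i j h => simp [leftOp_swap β h]⟩

theorem rep_mon (X : Finset (Fin n)) :
    rep β (mon β X) (Finsupp.single ∅ 1) = Finsupp.single X 1 := by
  induction X using Finset.induction_on_min with
  | empty => simp [mon_empty]
  | insert a X hX ih =>
    have haX : a ∉ X := fun h => lt_irrefl _ (hX a h)
    have hc : mvCoeff β a X = 1 := by
      unfold mvCoeff
      rw [Finset.filter_false_of_mem (fun j hj => (hX j hj).le.not_gt)]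
      simp
    have hg : rep β (gen β a) = leftOp β a := by simp [rep, gen]
    rw [mon_insert_of_lt β hX, map_mul, Module.End.mul_apply, ih, hg, leftOp_single,
      if_neg haX, hc, mul_one]

theorem linearIndependent_mon : LinearIndependent K (mon β) := by
  have h : LinearIndependent K
      (fun X : Finset (Fin n) => (Finsupp.single X 1 : Finset (Fin n) →₀ K)) :=
    Finsupp.linearIndependent_single_one K (Finset (Fin n))
  refine LinearIndependent.of_comp
    ((LinearMap.applyₗ (Finsupp.single ∅ (1 : K))).comp (rep β).toLinearMap) ?_
  convert h using 1
  funext X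
  exact rep_mon β X

theorem span_mon : ⊤ ≤ Submodule.span K (Set.range (mon β)) := by
  have key : ∀ (a : FreeAlgebra K (Fin n)),
      ∀ y ∈ Submodule.span K (Set.range (mon β)),
        RingQuot.mkAlgHom K (Rel β) a * y ∈ Submodule.span K (Set.range (mon β)) := by
    intro a
    induction a using FreeAlgebra.induction with
    | grade0 r =>
      intro y hy
      rw [AlgHom.commutes, ← Algebra.smul_def]
      exact Submodule.smul_mem _ _ hy
    | grade1 i =>
      intro y hy
      induction hy using Submodule.span_induction with
      | mem x hx =>
        obtain ⟨X, rfl⟩ := hx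
        have := gen_mul_mon β i X
        unfold gen at this
        rw [this]
        split_ifs
        · exact Submodule.zero_mem _
        · exact Submodule.smul_mem _ _ (Submodule.subset_span ⟨_, rfl⟩)
      | zero => simp
      | add x y _ _ hx hy => rw [mul_add]; exact Submodule.add_mem _ hx hy
      | smul c x _ hx => rw [mul_smul_comm]; exact Submodule.smul_mem _ _ hx
    | mul a b ha hb =>
      intro y hy
      rw [map_mul, mul_assoc]
      exact ha _ (hb _ hy)
    | add a b ha hb =>
      intro y hy
      rw [map_add, add_mul]
      exact Submodule.add_mem _ (ha _ hy) (hb _ hy)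
  intro x _
  obtain ⟨a, rfl⟩ := RingQuot.mkAlgHom_surjective K (Rel β) x
  have := key a 1 (Submodule.subset_span ⟨∅, mon_empty β⟩)
  simpa using this

/-- The monomials `e_X`, `X ⊆ [n]`, form a `K`-basis of the algebra. -/
def monBasis : Module.Basis (Finset (Fin n)) K (Alg β) :=
  Module.Basis.mk (linearIndependent_mon β) (span_mon β)

/-- The coefficient of `e_X` in `f`. -/
def coeff (f : Alg β) (X : Finset (Fin n)) : K := (monBasis β).repr f X

end Basis

section Matroid

variable {K : Type*} [Field K] {n : ℕ}

/-- The `χ`-boundary `∂ e_X = ∑_p (-1)^p χ(X ∖ i_p) e_{X ∖ i_p}` for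
`X = {i_1 < ⋯ < i_m}` with `m ≥ 2` (so `p` is the number of elements of `X` that are `≤ i_p`),
and `∂ e_i = 1`. -/
def boundary (β : Fin n → Fin n → Kˣ) (χ : Finset (Fin n) → K) (X : Finset (Fin n)) : Alg β :=
  if X.card = 1 then 1
  else ∑ i ∈ X, ((-1 : K) ^ (X.filter (· ≤ i)).card * χ (X.erase i)) • mon β (X.erase i)

/-- A set is unidependent if it contains a unique circuit. -/
def Unidependent (M : Matroid (Fin n)) (U : Finset (Fin n)) : Prop :=
  ∃! C : Finset (Fin n), M.IsCircuit (C : Set (Fin n)) ∧ C ⊆ U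

/-- The two conditions on `χ` under which the quotient by the `χ`-ideal is a `χ`-algebra. -/
structure IsChi (M : Matroid (Fin n)) (β : Fin n → Fin n → Kˣ) (χ : Finset (Fin n) → K) :
    Prop where
  ne_zero_iff : ∀ I : Finset (Fin n), χ I ≠ 0 ↔ M.Indep (I : Set (Fin n))
  boundary_eq : ∀ U U' : Finset (Fin n), Unidependent M U → Unidependent M U' → U' ⊆ U →
    ∃ ε : Kˣ, boundary β χ U = (ε : K) • (boundary β χ U' * mon β (U \ U'))

/-- The `χ`-ideal: the right ideal generated by the boundaries of the circuits with more than
one element and by the `e_i` with `i` a loop. -/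
def chiIdeal (M : Matroid (Fin n)) (β : Fin n → Fin n → Kˣ) (χ : Finset (Fin n) → K) :
    Submodule (Alg β)ᵐᵒᵖ (Alg β) :=
  Submodule.span (Alg β)ᵐᵒᵖ
    ({f | ∃ C : Finset (Fin n), M.IsCircuit (C : Set (Fin n)) ∧ 1 < C.card ∧
        f = boundary β χ C} ∪
     {f | ∃ i : Fin n, M.IsCircuit {i} ∧ f = gen β i})

/-- A term order, as a strict total order on the index sets of the monomials `e_X`:
`e_∅ = 1` is the least monomial, and the order is compatible with those products that do not
vanish (`e_X e_Z` is a nonzero multiple of `e_{X ∪ Z}` if `X ∩ Z = ∅`, and `0` otherwise). -/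
structure IsTermOrder (lt : Finset (Fin n) → Finset (Fin n) → Prop) : Prop where
  irrefl : ∀ X, ¬ lt X X
  trans : ∀ X Y Z, lt X Y → lt Y Z → lt X Z
  total : ∀ X Y, lt X Y ∨ X = Y ∨ lt Y X
  empty_lt : ∀ X, X ≠ ∅ → lt ∅ X
  mul_lt : ∀ X Y Z, lt X Y → Disjoint X Z → Disjoint Y Z → lt (X ∪ Z) (Y ∪ Z)

/-- `π` is compatible with the order: `e_i ≺ e_j` iff `i <_π j`, i.e. `π⁻¹ i < π⁻¹ j`. -/
def Compatible (lt : Finset (Fin n) → Finset (Fin n) → Prop) (π : Equiv.Perm (Fin n)) : Prop :=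
  ∀ i j : Fin n, lt {i} {j} ↔ π.symm i < π.symm j

/-- `e_X` is the leading monomial of `f` (and so `f ≠ 0`). -/
def IsLeading {β : Fin n → Fin n → Kˣ} (lt : Finset (Fin n) → Finset (Fin n) → Prop)
    (f : Alg β) (X : Finset (Fin n)) : Prop :=
  coeff β f X ≠ 0 ∧ ∀ Y, coeff β f Y ≠ 0 → Y ≠ X → lt Y X

/-- The set of leading monomials of the nonzero elements of `S`. -/
def leadingMons {β : Fin n → Fin n → Kˣ} (lt : Finset (Fin n) → Finset (Fin n) → Prop)
    (S : Set (Alg β)) : Set (Alg β) :=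
  {m | ∃ f ∈ S, ∃ X, IsLeading lt f X ∧ m = mon β X}

/-- The leading term ideal of `S`. (Every right ideal generated by monomials is two-sided.) -/
def ltIdeal {β : Fin n → Fin n → Kˣ} (lt : Finset (Fin n) → Finset (Fin n) → Prop)
    (S : Set (Alg β)) : Submodule (Alg β)ᵐᵒᵖ (Alg β) :=
  Submodule.span (Alg β)ᵐᵒᵖ (leadingMons lt S)

/-- `G` is a Gröbner basis of `J`. -/
structure IsGroebner {β : Fin n → Fin n → Kˣ} (lt : Finset (Fin n) → Finset (Fin n) → Prop)
    (J G : Set (Alg β)) : Prop where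
  subset : G ⊆ J
  ne_zero : ∀ g ∈ G, g ≠ 0
  lt_eq : ltIdeal lt G = ltIdeal lt J

/-- `G` is a reduced Gröbner basis of `J`: the leading coefficients are `1`, and no term of an
element is divisible by the leading monomial of another element. -/
structure IsReducedGroebner {β : Fin n → Fin n → Kˣ}
    (lt : Finset (Fin n) → Finset (Fin n) → Prop) (J G : Set (Alg β)) : Prop
    extends IsGroebner lt J G where
  monic : ∀ g ∈ G, ∀ X, IsLeading lt g X → coeff β g X = 1
  reduced : ∀ g ∈ G, ∀ g' ∈ G, g ≠ g' → ∀ X Y, IsLeading lt g X → coeff β g' Y ≠ 0 →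
    ¬ mon β X ∣ coeff β g' Y • mon β Y

/-- The subspace `K[𝕋_i]` spanned by the monomials `e_I` with `I` independent. -/
def indSpace (M : Matroid (Fin n)) (β : Fin n → Fin n → Kˣ) : Submodule K (Alg β) :=
  Submodule.span K {m | ∃ I : Finset (Fin n), M.Indep (I : Set (Fin n)) ∧ m = mon β I}

open Classical in
/-- The projection `p_i` onto `K[𝕋_i]` that kills the monomials of dependent sets. -/
def indProj (M : Matroid (Fin n)) (β : Fin n → Fin n → Kˣ) : Alg β →ₗ[K] Alg β :=
  (monBasis β).constr K fun X => if M.Indep (X : Set (Fin n)) then mon β X else 0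

/-- The product `f ⋆ g = p_i (f g)` of `K[𝕋_i]`. -/
def star (M : Matroid (Fin n)) {β : Fin n → Fin n → Kˣ} (f g : Alg β) : Alg β :=
  indProj M β (f * g)

/-- The right ideal of the algebra `(K[𝕋_i], ⋆)` generated by a subset `S` of `K[𝕋_i]`. -/
def indIdealSpan (M : Matroid (Fin n)) {β : Fin n → Fin n → Kˣ} (S : Set (Alg β)) :
    Submodule K (Alg β) :=
  sInf {N | S ⊆ N ∧ ∀ f ∈ N, ∀ h ∈ indSpace M β, star M f h ∈ N}

/-- `G` is a Gröbner basis of the ideal `J` of `(K[𝕋_i], ⋆)`. -/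
structure IsIndGroebner (M : Matroid (Fin n)) {β : Fin n → Fin n → Kˣ}
    (lt : Finset (Fin n) → Finset (Fin n) → Prop) (J G : Set (Alg β)) : Prop where
  subset : G ⊆ J
  ne_zero : ∀ g ∈ G, g ≠ 0
  lt_eq : indIdealSpan M (leadingMons lt G) = indIdealSpan M (leadingMons lt J)

/-- `G` is a reduced Gröbner basis of the ideal `J` of `(K[𝕋_i], ⋆)`. -/
structure IsReducedIndGroebner (M : Matroid (Fin n)) {β : Fin n → Fin n → Kˣ}
    (lt : Finset (Fin n) → Finset (Fin n) → Prop) (J G : Set (Alg β)) : Prop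
    extends IsIndGroebner M lt J G where
  monic : ∀ g ∈ G, ∀ X, IsLeading lt g X → coeff β g X = 1
  reduced : ∀ g ∈ G, ∀ g' ∈ G, g ≠ g' → ∀ X Y, IsLeading lt g X → coeff β g' Y ≠ 0 →
    ¬ ∃ h ∈ indSpace M β, coeff β g' Y • mon β Y = star M (mon β X) h

/-- `a` is the least element of `S` for the order `<_π`. -/
def IsPiLeast (π : Equiv.Perm (Fin n)) (S : Set (Fin n)) (a : Fin n) : Prop :=
  a ∈ S ∧ ∀ b ∈ S, π.symm a ≤ π.symm b

/-- `C` is a circuit whose `<_π`-least element `a` is also the `<_π`-least element of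
`cl(C ∖ a) ∖ (C ∖ a)`. -/
def IsPiCircuit (M : Matroid (Fin n)) (π : Equiv.Perm (Fin n)) (C : Finset (Fin n))
    (a : Fin n) : Prop :=
  M.IsCircuit (C : Set (Fin n)) ∧ IsPiLeast π C a ∧
    IsPiLeast π (M.closure ((C : Set (Fin n)) \ {a}) \ ((C : Set (Fin n)) \ {a})) a

/-- The set `ℭ_π` of circuits with this property whose broken part `C ∖ a` is minimal for
inclusion among the broken parts of such circuits. -/
def piCircuits (M : Matroid (Fin n)) (π : Equiv.Perm (Fin n)) : Set (Finset (Fin n)) :=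
  {C | ∃ a, IsPiCircuit M π C a ∧ ∀ C' a', IsPiCircuit M π C' a' →
    C'.erase a' ⊆ C.erase a → C'.erase a' = C.erase a}

/-- The boundaries `∂ e_C` of the circuits `C ∈ ℭ_π`. -/
def boundaryFamily (M : Matroid (Fin n)) (β : Fin n → Fin n → Kˣ) (χ : Finset (Fin n) → K)
    (π : Equiv.Perm (Fin n)) : Set (Alg β) :=
  {f | ∃ C ∈ piCircuits M π, f = boundary β χ C}

/-- The elements of `S`, each divided by its leading coefficient. -/
def normalize {β : Fin n → Fin n → Kˣ} (lt : Finset (Fin n) → Finset (Fin n) → Prop)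
    (S : Set (Alg β)) : Set (Alg β) :=
  {g | ∃ f ∈ S, ∃ X, IsLeading lt f X ∧ g = (coeff β f X)⁻¹ • f}

end Matroid

end ChiAlg

end

noncomputable section

namespace ChiAlg

/-! ### Broken circuits, levels of a flag, unidependent sets. -/

section Combinatorics

variable {n : ℕ} {M : Matroid (Fin n)} {π : Equiv.Perm (Fin n)}
  {lt : Finset (Fin n) → Finset (Fin n) → Prop}

/-! A circuit without its `<_π`-least element is a broken circuit, and the broken circuit of `C` is
the leading monomial of `∂e_C`. Everything rests on the converse: the leading monomial of a nonzero
element of the ideal contains a broken circuit. In other words, it is never `e_B` with `B` free of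
broken circuits (nbc).

A linear functional detects this. For independent `B`, the final segments of `B` for `<_π` span a
flag in `cl(B)`, and each element of `cl(B)` lies in exactly one level, indexed by an element of
`B`. Send `e_X` to `χ(X)⁻¹` times the determinant of the 0-1 incidence matrix between `X` and the
levels. On the boundary of a dependent set the values of `χ` cancel, and what remains expands a
determinant whose column of ones is the sum of the level columns, hence 0 (`sum_flagDet_erase`). By
the second axiom of a `χ`-algebra, `∂e_C e_Z` is a unit multiple of such a boundary or has only
dependent terms, so the functional kills the ideal (`flagFunctional_eq_zero_of_mem_chiIdeal`). If
`B` is nbc, the functional is nonzero on `e_B` and vanishes on `e_Y` unless `B = Y` or `B ≺ Y`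
(`lt_of_flagDet_ne_zero`). It therefore cannot kill an element with leading monomial `e_B`.

Every broken circuit contains one coming from `ℭ_π` (`exists_mem_piCircuits`), and
`eq_of_erase_subset_erase` gives reducedness. The functionals ignore dependent monomials, so they
factor through `p_i` and the same argument serves `K[𝕋_i]`. -/

theorem exists_isPiLeast (π : Equiv.Perm (Fin n)) {S : Set (Fin n)} (hS : S.Nonempty) :
    ∃ a, IsPiLeast π S a :=
  Set.exists_min_image S π.symm S.toFinite hS

theorem IsPiLeast.unique {S : Set (Fin n)} {a b : Fin n} (ha : IsPiLeast π S a)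
    (hb : IsPiLeast π S b) : a = b :=
  π.symm.injective (le_antisymm (ha.2 b hb.1) (hb.2 a ha.1))

theorem IsPiLeast.lt_of_mem {S : Set (Fin n)} {a b : Fin n} (ha : IsPiLeast π S a)
    (hb : b ∈ S) (hab : b ≠ a) : π.symm a < π.symm b :=
  lt_of_le_of_ne (ha.2 b hb) fun h => hab (π.symm.injective h.symm)

/-- An element of the closure of `S` outside `S` is on a circuit inside `S ∪ x`. -/
theorem exists_circuit_of_mem_closure {S : Set (Fin n)} {x : Fin n} (hx : x ∈ M.closure S)
    (hxS : x ∉ S) :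
    ∃ C : Finset (Fin n), M.IsCircuit (C : Set (Fin n)) ∧ x ∈ C ∧
      (C : Set (Fin n)) ⊆ insert x S := by
  obtain ⟨C, hCS, hC, hxC⟩ := (Matroid.mem_closure_iff_exists_isCircuit hxS).1 hx
  refine ⟨C.toFinite.toFinset, ?_, ?_, ?_⟩ <;> simpa

/-- A set without broken circuits. -/
def IsNbc (M : Matroid (Fin n)) (π : Equiv.Perm (Fin n)) (B : Finset (Fin n)) : Prop :=
  ∀ (C : Finset (Fin n)) (a : Fin n), M.IsCircuit (C : Set (Fin n)) → IsPiLeast π C a →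
    ¬ C.erase a ⊆ B

theorem IsNbc.indep (hE : M.E = Set.univ) {B : Finset (Fin n)} (hB : IsNbc M π B) :
    M.Indep (B : Set (Fin n)) := by
  by_contra h
  obtain ⟨C, hCB, hC⟩ := Matroid.Dep.exists_isCircuit_subset ⟨h, by simp [hE]⟩
  obtain ⟨a, ha⟩ := exists_isPiLeast π hC.nonempty
  refine hB C.toFinite.toFinset a (by simpa) (by simpa) ?_
  exact (Finset.erase_subset _ _).trans (by simpa using hCB)

/-- The level of `x` in the flag spanned by the final segments of `B` for `<_π`. -/
def IsLevel (M : Matroid (Fin n)) (π : Equiv.Perm (Fin n)) (B : Finset (Fin n))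
    (x b : Fin n) : Prop :=
  x ∈ M.closure {c | c ∈ B ∧ π.symm b ≤ π.symm c} ∧
    x ∉ M.closure {c | c ∈ B ∧ π.symm b < π.symm c}

/-- The final segments of `B` shrink to the empty set, whose closure is empty because there are no
loops. The level is the last segment whose closure still contains `x`. -/
theorem exists_isLevel (hM : M.Loopless) {B : Finset (Fin n)} {x : Fin n}
    (hx : x ∈ M.closure (B : Set (Fin n))) : ∃ b ∈ B, IsLevel M π B x b := by
  classical
  have hne : ∀ S : Set (Fin n), x ∈ M.closure S → S.Nonempty := by
    intro S h
    rw [Set.nonempty_iff_ne_empty]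
    rintro rfl
    simp [M.closure_empty] at h
  set T := B.filter fun b => x ∈ M.closure {c | c ∈ B ∧ π.symm b ≤ π.symm c} with hT
  have hTne : T.Nonempty := by
    obtain ⟨b, hb⟩ := exists_isPiLeast π (hne _ hx)
    refine ⟨b, Finset.mem_filter.2 ⟨hb.1, ?_⟩⟩
    refine M.closure_subset_closure ?_ hx
    exact fun c hc => ⟨hc, hb.2 c hc⟩
  obtain ⟨b, hbT, hb⟩ := Finset.exists_max_image T π.symm hTne
  obtain ⟨hbB, hxb⟩ := Finset.mem_filter.1 hbT
  refine ⟨b, hbB, hxb, fun h => ?_⟩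
  obtain ⟨b', hb'⟩ := exists_isPiLeast π (hne _ h)
  refine (hb b' (Finset.mem_filter.2 ⟨hb'.1.1, ?_⟩)).not_gt hb'.1.2
  refine M.closure_subset_closure ?_ h
  exact fun c hc => ⟨hc.1, hb'.2 c hc⟩

theorem IsLevel.le {B : Finset (Fin n)} {x b b' : Fin n} (h : IsLevel M π B x b)
    (h' : IsLevel M π B x b') : π.symm b' ≤ π.symm b := by
  by_contra hlt
  refine h.2 (M.closure_subset_closure ?_ h'.1)
  exact fun c hc => ⟨hc.1, (not_le.1 hlt).trans_le hc.2⟩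

theorem IsLevel.unique {B : Finset (Fin n)} {x b b' : Fin n} (h : IsLevel M π B x b)
    (h' : IsLevel M π B x b') : b = b' :=
  π.symm.injective (le_antisymm (h'.le h) (h.le h'))

theorem IsLevel.mem_closure {B : Finset (Fin n)} {x b : Fin n} (h : IsLevel M π B x b) :
    x ∈ M.closure (B : Set (Fin n)) :=
  M.closure_subset_closure (fun _ hc => hc.1) h.1

/-- In an independent set, the closure of a part contains no further element of the set. This makes
the incidence matrix of `B` with its own levels the identity. -/
theorem isLevel_self_iff (hE : M.E = Set.univ) {B : Finset (Fin n)}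
    (hB : M.Indep (B : Set (Fin n))) {b c : Fin n} (hc : c ∈ B) :
    IsLevel M π B c b ↔ c = b := by
  have key : ∀ S : Set (Fin n), S ⊆ B → (c ∈ M.closure S ↔ c ∈ S) := by
    intro S hS
    refine ⟨fun h => ?_, fun h => M.mem_closure_of_mem h (by simp [hE])⟩
    by_contra hcS
    have := (hB.subset (Set.insert_subset hc hS)).notMem_closure_sdiff_of_mem
      (Set.mem_insert c S)
    rw [Set.insert_sdiff_self_of_notMem hcS] at this
    exact this h
  unfold IsLevel
  rw [key _ (fun c hc => hc.1), key _ (fun c hc => hc.1)]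
  simp only [Set.mem_ofPred_eq, hc, true_and, not_lt]
  exact ⟨fun h => π.symm.injective (le_antisymm h.2 h.1), fun h => by simp [h]⟩

/-- A set with an element in each level spans `B`. -/
theorem subset_closure_of_isLevel {B : Finset (Fin n)} {X : Set (Fin n)}
    (h : ∀ b ∈ B, ∃ x ∈ X, IsLevel M π B x b) : (B : Set (Fin n)) ⊆ M.closure X := by
  -- Descending induction along `<_π`, starting at the largest elements of `B`.
  suffices ∀ k : ℕ, ∀ b ∈ B, n - (π.symm b : ℕ) ≤ k → b ∈ M.closure X from
    fun b hb => this _ b hb le_rfl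
  intro k
  induction k with
  | zero => intro b _ h; have := (π.symm b).2; omega
  | succ k ih =>
    intro b hb hk
    obtain ⟨x, hxX, hx1, hx2⟩ := h b hb
    set S : Set (Fin n) := {c | c ∈ B ∧ π.symm b < π.symm c}
    have hS : {c | c ∈ B ∧ π.symm b ≤ π.symm c} = insert b S := by
      ext c
      simp only [Set.mem_ofPred_eq, Set.mem_insert_iff, S, le_iff_lt_or_eq]
      constructor
      · rintro ⟨hc, h | h⟩
        · exact Or.inr ⟨hc, h⟩
        · exact Or.inl (π.symm.injective h.symm)
      · rintro (rfl | h)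
        · exact ⟨hb, Or.inr rfl⟩
        · exact ⟨h.1, Or.inl h.2⟩
    rw [hS] at hx1
    -- Modulo the later part `S` of the flag, `x` and `b` span the same level, so exchange recovers
    -- `b` from `x` and `S`.
    have hbx := (Matroid.closure_exchange ⟨hx1, hx2⟩).1
    have hsub : S ⊆ M.closure X := by
      rintro c ⟨hc, hlt⟩
      refine ih c hc ?_
      have := (π.symm c).2
      have : (π.symm b : ℕ) < π.symm c := hlt
      omega
    have hxE : x ∈ M.E := M.closure_subset_ground _ hx1
    have h3 : insert x S ⊆ M.closure (X ∩ M.E) := by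
      rw [M.closure_inter_ground]
      refine Set.insert_subset ?_ hsub
      rw [← M.closure_inter_ground]
      exact M.mem_closure_of_mem ⟨hxX, hxE⟩ Set.inter_subset_right
    have := M.closure_subset_closure_of_subset_closure h3 hbx
    rwa [M.closure_inter_ground] at this

theorem indep_of_subset_closure {B X : Finset (Fin n)} (hB : M.Indep (B : Set (Fin n)))
    (hcard : X.card = B.card) (h : (B : Set (Fin n)) ⊆ M.closure X) :
    M.Indep (X : Set (Fin n)) := by
  rw [Matroid.indep_iff_eRk_eq_encard_of_finite X.finite_toSet]
  refine le_antisymm (M.eRk_le_encard _) ?_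
  rw [Set.encard_coe_eq_coe_finsetCard, hcard, ← Set.encard_coe_eq_coe_finsetCard,
    ← hB.eRk_eq_encard, ← M.eRk_closure_eq (X : Set (Fin n))]
  exact M.eRk_mono h

/-- If `x <_π b`, then `x` closes a circuit with elements of `B` that are all `<_π`-larger than `x`,
and `B` contains the broken circuit. -/
theorem IsNbc.le_of_isLevel {B : Finset (Fin n)} (hB : IsNbc M π B) {x b : Fin n}
    (h : IsLevel M π B x b) : π.symm b ≤ π.symm x := by
  by_contra hlt
  rw [not_le] at hlt
  obtain ⟨C, hC, hxC, hCS⟩ := exists_circuit_of_mem_closure h.1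
    (fun hx => hlt.not_ge hx.2)
  refine hB C x hC ⟨hxC, fun c hc => ?_⟩ (fun c hc => ?_)
  · rcases hCS hc with rfl | hc
    · exact le_rfl
    · exact (hlt.trans_le hc.2).le
  · rcases hCS (Finset.mem_of_mem_erase hc) with rfl | hc'
    · exact absurd rfl (Finset.ne_of_mem_erase hc)
    · exact hc'.1

/-- Replace `a` by the least element `b` of `cl(C ∖ a) ∖ (C ∖ a)` and take a circuit through `b`
inside `b ∪ (C ∖ a)`. Since `b ≤_π a`, its least element is `b`, and its broken part spans no more
than `C ∖ a` does. -/
theorem exists_isPiCircuit {C : Finset (Fin n)} {a : Fin n} (hE : M.E = Set.univ)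
    (hC : M.IsCircuit (C : Set (Fin n))) (ha : IsPiLeast π C a) :
    ∃ C' a', IsPiCircuit M π C' a' ∧ C'.erase a' ⊆ C.erase a := by
  have haS : a ∈ M.closure ((C : Set (Fin n)) \ {a}) \ ((C : Set (Fin n)) \ {a}) := by
    refine ⟨?_, fun h => h.2 rfl⟩
    rw [hC.closure_sdiff_singleton_eq]
    exact M.mem_closure_of_mem ha.1 (by simp [hE])
  obtain ⟨b, hb⟩ := exists_isPiLeast π ⟨a, haS⟩
  obtain ⟨D, hD, hbD, hDS⟩ := exists_circuit_of_mem_closure hb.1.1 hb.1.2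
  have hDb : (D : Set (Fin n)) \ {b} ⊆ (C : Set (Fin n)) \ {a} := by
    rintro c ⟨hc, hcb⟩
    exact (hDS hc).resolve_left hcb
  have hlow : ∀ c ∈ (C : Set (Fin n)) \ {a}, π.symm b ≤ π.symm c := fun c hc =>
    (hb.2 a haS).trans (ha.2 c hc.1)
  refine ⟨D, b, ⟨hD, ⟨hbD, fun c hc => ?_⟩, ⟨⟨?_, fun h => h.2 rfl⟩, ?_⟩⟩, ?_⟩
  · rcases hDS hc with rfl | hc
    · exact le_rfl
    · exact hlow c hc
  · rw [hD.closure_sdiff_singleton_eq]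
    exact M.mem_closure_of_mem hbD (by simp [hE])
  · rintro c ⟨hc, -⟩
    by_cases hcC : c ∈ (C : Set (Fin n)) \ {a}
    · exact hlow c hcC
    · exact hb.2 c ⟨M.closure_subset_closure hDb hc, hcC⟩
  · rw [← Finset.coe_subset, Finset.coe_erase, Finset.coe_erase]
    exact hDb

theorem exists_mem_piCircuits {C : Finset (Fin n)} {a : Fin n} (hE : M.E = Set.univ)
    (hC : M.IsCircuit (C : Set (Fin n))) (ha : IsPiLeast π C a) :
    ∃ C' ∈ piCircuits M π, ∃ a', IsPiLeast π C' a' ∧ C'.erase a' ⊆ C.erase a := by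
  obtain ⟨C₁, a₁, h₁, hsub₁⟩ := exists_isPiCircuit hE hC ha
  set T : Set (Finset (Fin n)) :=
    {D | ∃ C' a', IsPiCircuit M π C' a' ∧ D = C'.erase a' ∧ D ⊆ C.erase a}
  obtain ⟨D, ⟨C', a', h', rfl, hsub⟩, hmin⟩ :=
    T.toFinite.exists_minimal ⟨_, C₁, a₁, h₁, rfl, hsub₁⟩
  refine ⟨C', ⟨a', h', fun C'' a'' h'' hs => ?_⟩, a', h'.2.1, hsub⟩
  exact le_antisymm hs (hmin ⟨C'', a'', h'', rfl, hs.trans hsub⟩ hs)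

theorem isNbc_of_piCircuits (hE : M.E = Set.univ) {B : Finset (Fin n)}
    (h : ∀ C ∈ piCircuits M π, ∀ a, IsPiLeast π C a → ¬ C.erase a ⊆ B) : IsNbc M π B := by
  intro C a hC ha hsub
  obtain ⟨C', hC', a', ha', hs⟩ := exists_mem_piCircuits hE hC ha
  exact h C' hC' a' ha' (hs.trans hsub)

theorem isCircuit_of_mem_piCircuits {C : Finset (Fin n)} (hC : C ∈ piCircuits M π) :
    M.IsCircuit (C : Set (Fin n)) := by
  obtain ⟨a, h, -⟩ := hC
  exact h.1

/-- If `C ∖ a ⊆ C' ∖ a'`, minimality makes the broken parts equal, and each broken part determines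
its missing element through its closure. Otherwise `a' ∈ C ∖ a`, so `a <_π a'`; but `a` lies in
`cl(C') = cl(C' ∖ a')`, against the choice of `a'` as a least element. -/
theorem eq_of_erase_subset_erase {C C' : Finset (Fin n)}
    (hC : C ∈ piCircuits M π) (hC' : C' ∈ piCircuits M π) {a i : Fin n}
    (ha : IsPiLeast π C a) (hsub : C.erase a ⊆ C'.erase i) : C = C' := by
  obtain ⟨b, hb, -⟩ := hC
  obtain ⟨a', ha', hmin⟩ := hC'
  obtain rfl : a = b := ha.unique hb.2.1
  by_cases hle : C.erase a ⊆ C'.erase a'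
  · have heq := hmin C a hb hle
    have h1 := hb.2.2
    rw [← Finset.coe_erase, heq, Finset.coe_erase] at h1
    obtain rfl := h1.unique ha'.2.2
    rw [← Finset.insert_erase (Finset.mem_coe.1 ha.1), heq,
      Finset.insert_erase (Finset.mem_coe.1 ha'.2.1.1)]
  · exfalso
    have ha'C : a' ∈ C.erase a := by
      by_contra hn
      refine hle fun c hc => Finset.mem_erase.2 ⟨?_, Finset.mem_of_mem_erase (hsub hc)⟩
      rintro rfl
      exact hn hc
    have hlt := ha.lt_of_mem (Finset.mem_of_mem_erase ha'C) (Finset.ne_of_mem_erase ha'C)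
    have hacl : a ∈ M.closure ((C' : Set (Fin n)) \ {a'}) := by
      rw [ha'.1.closure_sdiff_singleton_eq]
      have h1 := hb.2.2.1.1
      refine M.closure_subset_closure ?_ h1
      rw [← Finset.coe_erase, Finset.coe_subset]
      exact hsub.trans (Finset.erase_subset _ _)
    refine (ha'.2.2.2 a ⟨hacl, fun h => ?_⟩).not_gt hlt
    exact (ha'.2.1.2 a h.1).not_gt hlt

/-- Adding one element to an independent set creates at most one circuit, the fundamental one. -/
theorem unidependent_of_indep_erase_union {C Z : Finset (Fin n)} {i : Fin n}
    (hC : M.IsCircuit (C : Set (Fin n))) (hi : i ∈ C)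
    (h : M.Indep ((C.erase i ∪ Z : Finset (Fin n)) : Set (Fin n))) :
    Unidependent M (C ∪ Z) := by
  have hins : C ∪ Z = insert i (C.erase i ∪ Z) := by
    rw [← Finset.insert_union, Finset.insert_erase hi]
  refine ⟨C, ⟨hC, Finset.subset_union_left⟩, fun D hD => ?_⟩
  have key : ∀ D : Finset (Fin n), M.IsCircuit (D : Set (Fin n)) → D ⊆ C ∪ Z →
      (D : Set (Fin n)) = M.fundCircuit i ((C.erase i ∪ Z : Finset (Fin n)) : Set (Fin n)) := by
    intro D hD hDs
    refine hD.eq_fundCircuit_of_subset h ?_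
    rw [← Finset.coe_insert, ← hins]
    exact_mod_cast hDs
  exact Finset.coe_injective ((key D hD.1 hD.2).trans (key C hC Finset.subset_union_left).symm)

theorem unidependent_of_isCircuit {C : Finset (Fin n)} (hC : M.IsCircuit (C : Set (Fin n))) :
    Unidependent M C := by
  obtain ⟨i, hi⟩ := hC.nonempty
  have := unidependent_of_indep_erase_union (Z := ∅) hC hi
    (by simpa using hC.sdiff_singleton_indep hi)
  simpa using this

end Combinatorics

/-! ### Term orders and their compatible permutations. -/

section TermOrder

variable {n : ℕ} {M : Matroid (Fin n)} {π : Equiv.Perm (Fin n)}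
  {lt : Finset (Fin n) → Finset (Fin n) → Prop}

theorem IsTermOrder.subset (hlt : IsTermOrder lt) {X Y : Finset (Fin n)} (h : X ⊆ Y) :
    X = Y ∨ lt X Y := by
  rcases (Y \ X).eq_empty_or_nonempty with h0 | h0
  · exact Or.inl (Finset.Subset.antisymm h (Finset.sdiff_eq_empty_iff_subset.1 h0))
  · right
    have := hlt.mul_lt ∅ (Y \ X) X (hlt.empty_lt _ h0.ne_empty) (by simp)
      Finset.sdiff_disjoint
    rwa [Finset.empty_union, Finset.sdiff_union_of_subset h] at this

/-- Each element is moved up by `σ`, one at a time, and each move is a comparison of variables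
multiplied by a common monomial. -/
theorem IsTermOrder.image (hlt : IsTermOrder lt) (hπ : Compatible lt π) {σ : Fin n → Fin n}
    (B : Finset (Fin n)) (hinj : Set.InjOn σ B) (hle : ∀ b ∈ B, π.symm b ≤ π.symm (σ b)) :
    B = B.image σ ∨ lt B (B.image σ) := by
  induction B using Finset.induction_on_max_value π.symm with
  | empty => simp
  | insert a s has hmax ih =>
    have haσ : π.symm a ≤ π.symm (σ a) := hle a (Finset.mem_insert_self _ _)
    have ih := ih (hinj.mono (by simp)) fun b hb => hle b (Finset.mem_insert_of_mem hb)
    have hσa : σ a ∉ s.image σ := by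
      intro h
      obtain ⟨b, hb, hba⟩ := Finset.mem_image.1 h
      have := hinj (Finset.mem_coe.2 (Finset.mem_insert_of_mem hb))
        (Finset.mem_coe.2 (Finset.mem_insert_self a s)) hba
      exact has (this ▸ hb)
    -- Moving the `<_π`-largest element first keeps the products nonzero: `σ a` lies above all of
    -- `s`.
    have hσs : σ a ∉ s := by
      intro h
      have := π.symm.injective (le_antisymm haσ (hmax _ h))
      exact has (this ▸ h)
    have h1 : insert a s = insert (σ a) s ∨ lt (insert a s) (insert (σ a) s) := by
      rcases haσ.eq_or_lt with h | h
      · left; rw [← π.symm.injective h]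
      · right
        have := hlt.mul_lt {a} {σ a} s ((hπ _ _).2 h) (by simpa) (by simpa)
        rwa [← Finset.insert_eq, ← Finset.insert_eq] at this
    have h2 : insert (σ a) s = insert (σ a) (s.image σ) ∨
        lt (insert (σ a) s) (insert (σ a) (s.image σ)) := by
      rcases ih with h | h
      · left; rw [← h]
      · right
        have := hlt.mul_lt s (s.image σ) {σ a} h (by simpa) (by simpa using hσa)
        rwa [Finset.union_comm, Finset.union_comm _ {σ a}, ← Finset.insert_eq,
          ← Finset.insert_eq] at this
    rw [Finset.image_insert]
    rcases h1 with h1 | h1 <;> rcases h2 with h2 | h2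
    · exact Or.inl (h1.trans h2)
    · exact Or.inr (h1 ▸ h2)
    · exact Or.inr (h2 ▸ h1)
    · exact Or.inr (hlt.trans _ _ _ h1 h2)

/-- Both sets arise from `C ∖ {a, i}` by adding one element, and `e_a ≺ e_i`. -/
theorem IsTermOrder.erase_lt (hlt : IsTermOrder lt) (hπ : Compatible lt π)
    {C : Finset (Fin n)} {a i : Fin n} (ha : IsPiLeast π C a) (hi : i ∈ C) (hia : i ≠ a) :
    lt (C.erase i) (C.erase a) := by
  have haC : a ∈ C := ha.1
  have h := hlt.mul_lt {a} {i} ((C.erase a).erase i) ((hπ _ _).2 (ha.lt_of_mem hi hia))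
    (by simp) (by simp)
  rw [← Finset.insert_eq, ← Finset.insert_eq,
    Finset.insert_erase (Finset.mem_erase.2 ⟨hia, hi⟩), Finset.erase_right_comm,
    Finset.insert_erase (Finset.mem_erase.2 ⟨hia.symm, haC⟩)] at h
  exact h

/-- Every nonempty finite family of monomials has a greatest element. -/
theorem IsTermOrder.exists_greatest (hlt : IsTermOrder lt) (S : Finset (Finset (Fin n)))
    (hS : S.Nonempty) : ∃ X ∈ S, ∀ Y ∈ S, Y ≠ X → lt Y X := by
  induction hS using Finset.Nonempty.cons_induction with
  | singleton a => exact ⟨a, by simp, fun Y hY h => absurd (Finset.mem_singleton.1 hY) h⟩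
  | cons a s ha hs ih =>
    obtain ⟨X, hX, h⟩ := ih
    rcases hlt.total a X with haX | rfl | hXa
    · refine ⟨X, Finset.mem_cons_of_mem hX, fun Y hY hYX => ?_⟩
      rcases Finset.mem_cons.1 hY with rfl | hY
      · exact haX
      · exact h Y hY hYX
    · exact absurd hX ha
    · refine ⟨a, Finset.mem_cons_self _ _, fun Y hY hYa => ?_⟩
      have hY := (Finset.mem_cons.1 hY).resolve_left hYa
      by_cases hYX : Y = X
      · exact hYX ▸ hXa
      · exact hlt.trans _ _ _ (h Y hY hYX) hXa

end TermOrder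

/-! ### Coefficients and products of monomials. -/

section Algebra

variable {K : Type*} [Field K] {n : ℕ} {β : Fin n → Fin n → Kˣ}

theorem monBasis_apply (X : Finset (Fin n)) : monBasis β X = mon β X := by
  simp [monBasis]

theorem coeff_add (f g : Alg β) (X : Finset (Fin n)) :
    coeff β (f + g) X = coeff β f X + coeff β g X := by simp [coeff]

theorem coeff_sub (f g : Alg β) (X : Finset (Fin n)) :
    coeff β (f - g) X = coeff β f X - coeff β g X := by simp [coeff]

theorem coeff_smul (c : K) (f : Alg β) (X : Finset (Fin n)) :
    coeff β (c • f) X = c * coeff β f X := by simp [coeff]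

theorem coeff_sum {ι : Type*} (s : Finset ι) (f : ι → Alg β) (X : Finset (Fin n)) :
    coeff β (∑ i ∈ s, f i) X = ∑ i ∈ s, coeff β (f i) X := by
  simp [coeff, Finsupp.finsetSum_apply]

theorem coeff_zero (X : Finset (Fin n)) : coeff β (0 : Alg β) X = 0 := by simp [coeff]

theorem coeff_mon (X Y : Finset (Fin n)) :
    coeff β (mon β X) Y = if X = Y then 1 else 0 := by
  rw [coeff, ← monBasis_apply, Module.Basis.repr_self, Finsupp.single_apply]

theorem sum_coeff (f : Alg β) : ∑ X, coeff β f X • mon β X = f := by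
  simpa [coeff, monBasis_apply] using (monBasis β).sum_repr f

theorem exists_coeff_ne_zero {f : Alg β} (hf : f ≠ 0) : ∃ X, coeff β f X ≠ 0 := by
  by_contra! h
  exact hf (by rw [← sum_coeff f]; simp [h])

theorem mvCoeff_ne_zero (i : Fin n) (X : Finset (Fin n)) : mvCoeff β i X ≠ 0 :=
  Finset.prod_ne_zero_iff.2 fun j _ => (β j i).ne_zero

theorem mon_mul_mon (X Z : Finset (Fin n)) :
    ∃ c : K, c ≠ 0 ∧ mon β X * mon β Z = if Disjoint X Z then c • mon β (X ∪ Z) else 0 := by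
  induction X using Finset.induction_on_min with
  | empty => exact ⟨1, one_ne_zero, by simp [mon_empty]⟩
  | insert a X hX ih =>
    obtain ⟨c, hc, h⟩ := ih
    have haX : a ∉ X := fun h => lt_irrefl _ (hX a h)
    refine ⟨c * mvCoeff β a (X ∪ Z), mul_ne_zero hc (mvCoeff_ne_zero _ _), ?_⟩
    rw [mon_insert_of_lt β hX, mul_assoc, h]
    simp only [Finset.disjoint_insert_left]
    by_cases hd : Disjoint X Z
    · by_cases haZ : a ∈ Z
      · simp [hd, haZ, gen_mul_mon]
      · simp [hd, haZ, haX, gen_mul_mon, smul_smul]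
    · simp [hd]

theorem mon_mul_mon_of_disjoint {X Z : Finset (Fin n)} (h : Disjoint X Z) :
    ∃ c : K, c ≠ 0 ∧ mon β X * mon β Z = c • mon β (X ∪ Z) := by
  obtain ⟨c, hc, hm⟩ := mon_mul_mon (β := β) X Z
  exact ⟨c, hc, by rw [hm, if_pos h]⟩

theorem mon_mul_mon_of_not_disjoint {X Z : Finset (Fin n)} (h : ¬ Disjoint X Z) :
    mon β X * mon β Z = 0 := by
  obtain ⟨c, -, hm⟩ := mon_mul_mon (β := β) X Z
  rw [hm, if_neg h]

theorem exists_mon_eq_mul {X Y : Finset (Fin n)} (h : X ⊆ Y) :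
    ∃ c : K, mon β Y = mon β X * (c • mon β (Y \ X)) := by
  obtain ⟨c, hc, hm⟩ := mon_mul_mon_of_disjoint (β := β)
    (Finset.disjoint_sdiff (s := X) (t := Y))
  refine ⟨c⁻¹, ?_⟩
  rw [mul_smul_comm, hm, smul_smul, inv_mul_cancel₀ hc, one_smul,
    Finset.union_sdiff_of_subset h]

theorem subset_of_coeff_mon_mul_ne_zero {X Y : Finset (Fin n)} {f : Alg β}
    (h : coeff β (mon β X * f) Y ≠ 0) : X ⊆ Y := by
  rw [← sum_coeff f, Finset.mul_sum, coeff_sum] at h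
  obtain ⟨Z, -, hZ⟩ := Finset.exists_ne_zero_of_sum_ne_zero h
  obtain ⟨c, -, hm⟩ := mon_mul_mon (β := β) X Z
  rw [mul_smul_comm, coeff_smul, hm] at hZ
  split_ifs at hZ with hd
  · rw [coeff_smul, coeff_mon] at hZ
    split_ifs at hZ with hY
    · exact hY ▸ Finset.subset_union_left
    · simp at hZ
  · simp [coeff_zero] at hZ

theorem exists_subset_of_coeff_mul_ne_zero {Y : Finset (Fin n)} {f g : Alg β}
    (h : coeff β (f * g) Y ≠ 0) : ∃ X, coeff β f X ≠ 0 ∧ X ⊆ Y := by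
  rw [← sum_coeff f, Finset.sum_mul, coeff_sum] at h
  obtain ⟨X, -, hX⟩ := Finset.exists_ne_zero_of_sum_ne_zero h
  rw [smul_mul_assoc, coeff_smul] at hX
  exact ⟨X, left_ne_zero_of_mul hX, subset_of_coeff_mon_mul_ne_zero (right_ne_zero_of_mul hX)⟩

end Algebra

/-! ### Leading monomials and uniqueness of reduced Gröbner bases. -/

section Leading

variable {K : Type*} [Field K] {n : ℕ} {β : Fin n → Fin n → Kˣ}
  {lt : Finset (Fin n) → Finset (Fin n) → Prop}

theorem IsLeading.unique (hlt : IsTermOrder lt) {f : Alg β} {X Y : Finset (Fin n)}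
    (hX : IsLeading lt f X) (hY : IsLeading lt f Y) : X = Y := by
  by_contra h
  exact hlt.irrefl _ (hlt.trans _ _ _ (hX.2 Y hY.1 (Ne.symm h)) (hY.2 X hX.1 h))

theorem IsLeading.ne_zero {f : Alg β} {X : Finset (Fin n)} (hX : IsLeading lt f X) : f ≠ 0 := by
  rintro rfl
  exact hX.1 (coeff_zero X)

theorem exists_isLeading (hlt : IsTermOrder lt) {f : Alg β} (hf : f ≠ 0) :
    ∃ X, IsLeading lt f X := by
  classical
  obtain ⟨X, hX⟩ := exists_coeff_ne_zero hf
  obtain ⟨Y, hY, h⟩ := hlt.exists_greatest (Finset.univ.filter fun Y => coeff β f Y ≠ 0)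
    ⟨X, by simpa⟩
  exact ⟨Y, by simpa using hY, fun Z hZ => h Z (by simpa using hZ)⟩

theorem isLeading_smul_iff {f : Alg β} {X : Finset (Fin n)} {c : K} (hc : c ≠ 0) :
    IsLeading lt (c • f) X ↔ IsLeading lt f X := by
  simp [IsLeading, coeff_smul, hc]

theorem leadingMons_mono {S T : Set (Alg β)} (h : S ⊆ T) :
    leadingMons lt S ⊆ leadingMons lt T := by
  rintro m ⟨f, hf, X, hX, rfl⟩
  exact ⟨f, h hf, X, hX, rfl⟩

theorem leadingMons_normalize (S : Set (Alg β)) :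
    leadingMons lt (normalize lt S) = leadingMons lt S := by
  ext m
  constructor
  · rintro ⟨g, ⟨f, hf, X, hX, rfl⟩, Y, hY, rfl⟩
    exact ⟨f, hf, Y, (isLeading_smul_iff (inv_ne_zero hX.1)).1 hY, rfl⟩
  · rintro ⟨f, hf, X, hX, rfl⟩
    exact ⟨_, ⟨f, hf, X, hX, rfl⟩, X, (isLeading_smul_iff (inv_ne_zero hX.1)).2 hX, rfl⟩

theorem mon_mem_ltIdeal {S : Set (Alg β)} {f : Alg β} {X Y : Finset (Fin n)} (hf : f ∈ S)
    (hX : IsLeading lt f X) (hXY : X ⊆ Y) : mon β Y ∈ ltIdeal lt S := by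
  obtain ⟨c, hc⟩ := exists_mon_eq_mul (β := β) hXY
  rw [hc]
  exact Submodule.smul_mem _ (MulOpposite.op _)
    (Submodule.subset_span ⟨f, hf, X, hX, rfl⟩)

/-- Right multiplication only enlarges the index sets of terms, so membership in a monomial ideal is
visible term by term. -/
theorem exists_isLeading_subset_of_mem_ltIdeal {S : Set (Alg β)} {f : Alg β}
    (hf : f ∈ ltIdeal lt S) {Y : Finset (Fin n)} (hY : coeff β f Y ≠ 0) :
    ∃ g ∈ S, ∃ X, IsLeading lt g X ∧ X ⊆ Y := by
  induction hf using Submodule.span_induction generalizing Y with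
  | mem m hm =>
    obtain ⟨g, hg, X, hX, rfl⟩ := hm
    refine ⟨g, hg, X, hX, ?_⟩
    rw [coeff_mon] at hY
    split_ifs at hY with h
    · exact h.subset
    · exact absurd rfl hY
  | zero => exact absurd (coeff_zero Y) hY
  | add x y _ _ hx hy =>
    rw [coeff_add] at hY
    by_cases h : coeff β x Y = 0
    · exact hy (by simpa [h] using hY)
    · exact hx h
  | smul a x _ hx =>
    obtain ⟨X, hX, hXY⟩ := exists_subset_of_coeff_mul_ne_zero (f := x) (g := a.unop) hY
    obtain ⟨g, hg, Z, hZ, hZX⟩ := hx hX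
    exact ⟨g, hg, Z, hZ, hZX.trans hXY⟩

theorem IsReducedGroebner.eq_of_dvd {J G : Set (Alg β)}
    (hG : IsReducedGroebner lt J G) {g g' : Alg β} (hg : g ∈ G) (hg' : g' ∈ G)
    {X Y : Finset (Fin n)} (hX : IsLeading lt g X) (hY : coeff β g' Y ≠ 0) (hXY : X ⊆ Y) :
    g = g' := by
  by_contra h
  obtain ⟨c, hc⟩ := exists_mon_eq_mul (β := β) hXY
  refine hG.reduced g hg g' hg' h X Y hX hY ?_
  rw [hc, ← mul_smul_comm]
  exact dvd_mul_right _ _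

theorem IsGroebner.exists_isLeading_subset {J G : Set (Alg β)}
    (hG : IsGroebner lt J G) {f : Alg β} (hf : f ∈ J) {X : Finset (Fin n)}
    (hX : IsLeading lt f X) : ∃ g ∈ G, ∃ Y, IsLeading lt g Y ∧ Y ⊆ X := by
  have h : mon β X ∈ ltIdeal lt G := by
    rw [hG.lt_eq]
    exact mon_mem_ltIdeal hf hX subset_rfl
  exact exists_isLeading_subset_of_mem_ltIdeal h (by simp [coeff_mon])

/-- A term of an element of a reduced Gröbner basis that is the leading monomial of some element
of the ideal is the leading monomial of this element. -/
theorem IsReducedGroebner.isLeading_of_coeff_ne_zero (hlt : IsTermOrder lt) {J G : Set (Alg β)}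
    (hG : IsReducedGroebner lt J G) {g f : Alg β} (hg : g ∈ G) (hf : f ∈ J)
    {W : Finset (Fin n)} (hW : IsLeading lt f W) (hgW : coeff β g W ≠ 0) :
    IsLeading lt g W := by
  obtain ⟨g', hg', Y, hY, hYW⟩ := hG.toIsGroebner.exists_isLeading_subset hf hW
  obtain rfl := hG.eq_of_dvd hg' hg hY hgW hYW
  rcases hlt.subset hYW with rfl | h
  · exact hY
  · by_cases hne : W = Y
    · exact hne ▸ hY
    · exact absurd (hlt.trans _ _ _ h (hY.2 W hgW hne)) (hlt.irrefl _)

theorem IsReducedGroebner.subset_of_isReducedGroebner (hlt : IsTermOrder lt)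
    {J : Submodule (Alg β)ᵐᵒᵖ (Alg β)} {G H : Set (Alg β)}
    (hG : IsReducedGroebner lt (J : Set (Alg β)) G)
    (hH : IsReducedGroebner lt (J : Set (Alg β)) H) : G ⊆ H := by
  intro g hg
  obtain ⟨X, hX⟩ := exists_isLeading hlt (hG.ne_zero g hg)
  obtain ⟨h, hh, Y, hY, hYX⟩ := hH.toIsGroebner.exists_isLeading_subset (hG.subset hg) hX
  obtain ⟨g', hg', Z, hZ, hZY⟩ := hG.toIsGroebner.exists_isLeading_subset (hH.subset hh) hY
  obtain rfl := hG.eq_of_dvd hg' hg hZ hX.1 (hZY.trans hYX)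
  obtain rfl := hZ.unique hlt hX
  obtain rfl := Finset.Subset.antisymm hYX hZY
  -- The two elements share their leading monomial and are monic. A nonzero difference would have a
  -- smaller leading monomial `W`, a term of one of them; reducedness forces `W` to be that
  -- element's leading monomial.
  by_cases hgh : g' - h = 0
  · rwa [sub_eq_zero.1 hgh]
  exfalso
  obtain ⟨W, hW⟩ := exists_isLeading hlt hgh
  have hmem : g' - h ∈ J := J.sub_mem (hG.subset hg) (hH.subset hh)
  have hWY : W ≠ Y := by
    rintro rfl
    apply hW.1
    rw [coeff_sub, hG.monic _ hg _ hX, hH.monic _ hh _ hY, sub_self]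
  by_cases h1 : coeff β g' W = 0
  · have h2 : coeff β h W ≠ 0 := by
      intro h2
      exact hW.1 (by rw [coeff_sub, h1, h2, sub_self])
    exact hWY ((hH.isLeading_of_coeff_ne_zero hlt hh hmem hW h2).unique hlt hY)
  · exact hWY ((hG.isLeading_of_coeff_ne_zero hlt hg hmem hW h1).unique hlt hX)

theorem IsReducedGroebner.unique (hlt : IsTermOrder lt)
    {J : Submodule (Alg β)ᵐᵒᵖ (Alg β)} {G H : Set (Alg β)}
    (hG : IsReducedGroebner lt (J : Set (Alg β)) G)
    (hH : IsReducedGroebner lt (J : Set (Alg β)) H) : G = H :=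
  (hG.subset_of_isReducedGroebner hlt hH).antisymm (hH.subset_of_isReducedGroebner hlt hG)

end Leading

/-! ### Terms and leading monomials of boundaries. -/

section Boundary

variable {K : Type*} [Field K] {n : ℕ} {M : Matroid (Fin n)} {π : Equiv.Perm (Fin n)}
  {β : Fin n → Fin n → Kˣ} {χ : Finset (Fin n) → K}
  {lt : Finset (Fin n) → Finset (Fin n) → Prop}

theorem one_lt_card_of_not_indep (hE : M.E = Set.univ) (hM : M.Loopless) {U : Finset (Fin n)}
    (hU : ¬ M.Indep (U : Set (Fin n))) : 1 < U.card := by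
  by_contra! h
  rcases U.eq_empty_or_nonempty with rfl | ⟨x, hx⟩
  · exact hU (by simp)
  · obtain rfl : U = {x} := Finset.eq_singleton_iff_unique_mem.2
      ⟨hx, fun y hy => Finset.card_le_one.1 h y hy x hx⟩
    apply hU
    rw [Finset.coe_singleton, Matroid.indep_singleton]
    exact Matroid.isNonloop_of_loopless (by simp [hE])

/-- Without loops, a dependent set has at least two elements, so the convention `∂e_i = 1` does not
interfere. -/
theorem boundary_of_not_indep (hE : M.E = Set.univ) (hM : M.Loopless) {U : Finset (Fin n)}
    (hU : ¬ M.Indep (U : Set (Fin n))) :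
    boundary β χ U =
      ∑ i ∈ U, ((-1 : K) ^ (U.filter (· ≤ i)).card * χ (U.erase i)) • mon β (U.erase i) :=
  if_neg (one_lt_card_of_not_indep hE hM hU).ne'

theorem exists_of_coeff_boundary_ne_zero (hE : M.E = Set.univ) (hM : M.Loopless)
    {C : Finset (Fin n)} (hC : M.IsCircuit (C : Set (Fin n))) {Y : Finset (Fin n)}
    (hY : coeff β (boundary β χ C) Y ≠ 0) : ∃ i ∈ C, Y = C.erase i := by
  rw [boundary_of_not_indep hE hM hC.not_indep, coeff_sum] at hY
  obtain ⟨i, hi, h⟩ := Finset.exists_ne_zero_of_sum_ne_zero hY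
  rw [coeff_smul, coeff_mon] at h
  refine ⟨i, hi, ?_⟩
  by_contra hne
  simp [Ne.symm hne] at h

theorem indep_erase_of_isCircuit {C : Finset (Fin n)} (hC : M.IsCircuit (C : Set (Fin n)))
    {i : Fin n} (hi : i ∈ C) : M.Indep ((C.erase i : Finset (Fin n)) : Set (Fin n)) := by
  rw [Finset.coe_erase]
  exact hC.sdiff_singleton_indep hi

theorem coeff_boundary_erase_ne_zero (hE : M.E = Set.univ) (hM : M.Loopless)
    (hχ : IsChi M β χ) {C : Finset (Fin n)} (hC : M.IsCircuit (C : Set (Fin n))) {i : Fin n}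
    (hi : i ∈ C) : coeff β (boundary β χ C) (C.erase i) ≠ 0 := by
  rw [boundary_of_not_indep hE hM hC.not_indep, coeff_sum, Finset.sum_eq_single i]
  · rw [coeff_smul, coeff_mon, if_pos rfl, mul_one]
    exact mul_ne_zero (pow_ne_zero _ (by simp)) ((hχ.ne_zero_iff _).2 (indep_erase_of_isCircuit hC hi))
  · intro j hj hji
    rw [coeff_smul, coeff_mon, if_neg, mul_zero]
    intro h
    have : j ∈ C.erase i := Finset.mem_erase.2 ⟨hji, hj⟩
    rw [← h] at this
    simp at this
  · exact fun h => absurd hi h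

theorem isLeading_boundary (hE : M.E = Set.univ) (hM : M.Loopless)
    (hχ : IsChi M β χ) (hlt : IsTermOrder lt) (hπ : Compatible lt π) {C : Finset (Fin n)}
    (hC : M.IsCircuit (C : Set (Fin n))) {a : Fin n} (ha : IsPiLeast π C a) :
    IsLeading lt (boundary β χ C) (C.erase a) := by
  refine ⟨coeff_boundary_erase_ne_zero hE hM hχ hC ha.1, fun Y hY hne => ?_⟩
  obtain ⟨i, hi, rfl⟩ := exists_of_coeff_boundary_ne_zero hE hM hC hY
  exact hlt.erase_lt hπ ha hi (by rintro rfl; exact hne rfl)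

theorem coeff_indProj (f : Alg β) (Y : Finset (Fin n)) [Decidable (M.Indep (Y : Set (Fin n)))] :
    coeff β (indProj M β f) Y =
      if M.Indep (Y : Set (Fin n)) then coeff β f Y else 0 := by
  conv_lhs => rw [← sum_coeff f, map_sum, coeff_sum]
  rw [Finset.sum_eq_single Y]
  · rw [map_smul, coeff_smul, ← monBasis_apply, indProj, Module.Basis.constr_basis]
    split_ifs <;> simp [coeff_mon, coeff_zero]
  · intro X _ hXY
    rw [map_smul, coeff_smul, ← monBasis_apply, indProj, Module.Basis.constr_basis]
    split_ifs <;> simp [coeff_mon, coeff_zero, hXY]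
  · simp

theorem indProj_mon {X : Finset (Fin n)} (h : M.Indep (X : Set (Fin n))) :
    indProj M β (mon β X) = mon β X := by
  rw [← monBasis_apply, indProj, Module.Basis.constr_basis, if_pos h, monBasis_apply]

theorem indProj_boundary (hE : M.E = Set.univ) (hM : M.Loopless)
    {C : Finset (Fin n)} (hC : M.IsCircuit (C : Set (Fin n))) :
    indProj M β (boundary β χ C) = boundary β χ C := by
  rw [boundary_of_not_indep hE hM hC.not_indep, map_sum]
  refine Finset.sum_congr rfl fun i hi => ?_
  rw [map_smul, indProj_mon (indep_erase_of_isCircuit hC hi)]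

theorem boundary_mem_chiIdeal (hE : M.E = Set.univ) (hM : M.Loopless)
    {C : Finset (Fin n)} (hC : M.IsCircuit (C : Set (Fin n))) :
    boundary β χ C ∈ chiIdeal M β χ :=
  Submodule.subset_span (Or.inl ⟨C, hC, one_lt_card_of_not_indep hE hM hC.not_indep, rfl⟩)

end Boundary

/-! ### The functionals attached to flags. -/

section Functional

open Classical in
/-- The determinant of the incidences between `X` and the levels of the flag of `B`. -/
def flagDet (K : Type*) [Field K] {n : ℕ} (M : Matroid (Fin n)) (π : Equiv.Perm (Fin n))
    (B X : Finset (Fin n)) : K :=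
  if h : X.card = B.card then
    Matrix.det (Matrix.of fun p j : Fin B.card =>
      if IsLevel M π B (X.orderEmbOfFin h p) (B.orderEmbOfFin rfl j) then (1 : K) else 0)
  else 0

variable {K : Type*} [Field K] {n : ℕ} {M : Matroid (Fin n)} {π : Equiv.Perm (Fin n)}

theorem exists_orderEmbOfFin_eq {X : Finset (Fin n)} {k : ℕ} (h : X.card = k) {x : Fin n}
    (hx : x ∈ X) : ∃ p, X.orderEmbOfFin h p = x := by
  have : x ∈ Set.range (X.orderEmbOfFin h) := by rw [Finset.range_orderEmbOfFin]; exact hx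
  exact this

theorem exists_isLevel_of_flagDet_ne_zero {B X : Finset (Fin n)} (h : flagDet K M π B X ≠ 0) :
    ∀ b ∈ B, ∃ x ∈ X, IsLevel M π B x b := by
  intro b hb
  by_contra! hx
  apply h
  unfold flagDet
  split_ifs with hc
  · obtain ⟨j, rfl⟩ := exists_orderEmbOfFin_eq rfl hb
    refine Matrix.det_eq_zero_of_column_eq_zero j fun p => ?_
    rw [Matrix.of_apply, if_neg (hx _ (Finset.orderEmbOfFin_mem _ _ _))]
  · rfl

theorem mem_closure_of_flagDet_ne_zero {B X : Finset (Fin n)} (h : flagDet K M π B X ≠ 0)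
    {x : Fin n} (hx : x ∈ X) : x ∈ M.closure (B : Set (Fin n)) := by
  by_contra hxB
  apply h
  unfold flagDet
  split_ifs with hc
  · obtain ⟨p, rfl⟩ := exists_orderEmbOfFin_eq hc hx
    refine Matrix.det_eq_zero_of_row_eq_zero p fun j => ?_
    rw [Matrix.of_apply, if_neg fun hl => hxB hl.mem_closure]
  · rfl

theorem card_eq_of_flagDet_ne_zero {B X : Finset (Fin n)} (h : flagDet K M π B X ≠ 0) :
    X.card = B.card := by
  by_contra hc
  exact h (dif_neg hc)

/-- No column vanishes, so `X` meets every level and spans `B`; having only `|B|` elements, it is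
independent. -/
theorem indep_of_flagDet_ne_zero {B X : Finset (Fin n)} (hB : M.Indep (B : Set (Fin n)))
    (h : flagDet K M π B X ≠ 0) : M.Indep (X : Set (Fin n)) :=
  indep_of_subset_closure hB (card_eq_of_flagDet_ne_zero h)
    (subset_closure_of_isLevel (exists_isLevel_of_flagDet_ne_zero h))

theorem flagDet_self (hE : M.E = Set.univ) {B : Finset (Fin n)}
    (hB : M.Indep (B : Set (Fin n))) : flagDet K M π B B = 1 := by
  rw [flagDet, dif_pos rfl]
  refine (congrArg Matrix.det ?_).trans Matrix.det_one
  ext p j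
  rw [Matrix.of_apply, Matrix.one_apply]
  simp only [isLevel_self_iff hE hB (Finset.orderEmbOfFin_mem _ _ _),
    EmbeddingLike.apply_eq_iff_eq]

theorem card_filter_le_orderEmbOfFin {U : Finset (Fin n)} {k : ℕ} (h : U.card = k) (p : Fin k) :
    (U.filter (· ≤ U.orderEmbOfFin h p)).card = p + 1 := by
  have : U.filter (· ≤ U.orderEmbOfFin h p) =
      (Finset.Iic p).map (U.orderEmbOfFin h).toEmbedding := by
    ext x
    simp only [Finset.mem_filter, Finset.mem_map, Finset.mem_Iic]
    constructor
    · rintro ⟨hx, hle⟩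
      obtain ⟨q, rfl⟩ := exists_orderEmbOfFin_eq h hx
      exact ⟨q, (U.orderEmbOfFin h).le_iff_le.1 hle, rfl⟩
    · rintro ⟨q, hq, rfl⟩
      exact ⟨Finset.orderEmbOfFin_mem _ _ _, (U.orderEmbOfFin h).le_iff_le.2 hq⟩
  rw [this, Finset.card_map, Fin.card_Iic]

/-- The relation of determinants given by a column of ones. -/
theorem sum_flagDet_erase_of_subset (hM : M.Loopless) {B U : Finset (Fin n)}
    (hcard : U.card = B.card + 1) (hU : (U : Set (Fin n)) ⊆ M.closure B) :
    ∑ i ∈ U, (-1 : K) ^ (U.filter (· ≤ i)).card * flagDet K M π B (U.erase i) = 0 := by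
  classical
  have hsum : ∀ f : Fin n → K, ∑ i ∈ U, f i = ∑ p, f (U.orderEmbOfFin hcard p) := by
    intro f
    conv_lhs => rw [← U.map_orderEmbOfFin_univ hcard, Finset.sum_map]
    rfl
  let A : Matrix (Fin (B.card + 1)) (Fin (B.card + 1)) K := Matrix.of fun p =>
    Fin.cons 1 fun j =>
      if IsLevel M π B (U.orderEmbOfFin hcard p) (B.orderEmbOfFin rfl j) then 1 else 0
  have hdet : A.det = 0 := by
    -- Each row has exactly one 1 among the level columns, so `(1, -1, …, -1)` is in the kernel.
    refine Matrix.exists_mulVec_eq_zero_iff.1 ⟨Fin.cons 1 fun _ => -1, fun h => ?_, ?_⟩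
    · simpa using congrFun h 0
    · funext p
      obtain ⟨b, hb, hpb⟩ := exists_isLevel (π := π) hM (hU (U.orderEmbOfFin_mem hcard p))
      obtain ⟨j, rfl⟩ := exists_orderEmbOfFin_eq rfl hb
      have huniq : ∀ j', IsLevel M π B (U.orderEmbOfFin hcard p) (B.orderEmbOfFin rfl j') ↔
          j = j' := fun j' =>
        ⟨fun h => (B.orderEmbOfFin rfl).injective (hpb.unique h), fun h => h ▸ hpb⟩
      simp [A, Matrix.mulVec, dotProduct, Fin.sum_univ_succ, huniq]
  rw [Matrix.det_succ_column_zero] at hdet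
  -- The boundary counts positions from 1 and the Laplace expansion from 0, hence the global sign.
  rw [hsum, ← neg_eq_zero, ← Finset.sum_neg_distrib, ← hdet]
  refine Finset.sum_congr rfl fun p _ => ?_
  have hc : (U.erase (U.orderEmbOfFin hcard p)).card = B.card := by
    rw [Finset.card_erase_of_mem (Finset.orderEmbOfFin_mem _ _ _), hcard, Nat.add_sub_cancel]
  have hemb : (fun q => U.orderEmbOfFin hcard (p.succAbove q)) =
      (U.erase (U.orderEmbOfFin hcard p)).orderEmbOfFin hc := by
    refine Finset.orderEmbOfFin_unique hc (fun q => ?_)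
      ((U.orderEmbOfFin hcard).strictMono.comp (Fin.strictMono_succAbove p))
    refine Finset.mem_erase.2 ⟨?_, Finset.orderEmbOfFin_mem _ _ _⟩
    exact (U.orderEmbOfFin hcard).injective.ne (Fin.succAbove_ne p q)
  rw [card_filter_le_orderEmbOfFin, flagDet, dif_pos hc, pow_succ]
  have hA : A p 0 = 1 := rfl
  have hsub : A.submatrix p.succAbove Fin.succ = Matrix.of fun q j : Fin B.card =>
      if IsLevel M π B ((U.erase (U.orderEmbOfFin hcard p)).orderEmbOfFin hc q)
        (B.orderEmbOfFin rfl j) then (1 : K) else 0 := by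
    ext q j
    rw [Matrix.of_apply, ← congrFun hemb q]
    rfl
  rw [hA, hsub]
  ring

/-- One nonzero term already puts `U` in the previous situation: `U ∖ i` is then independent, of
size `|B|` and inside `cl(B)`, and the dependence of `U` forces `i` into `cl(U ∖ i)`. -/
theorem sum_flagDet_erase (hE : M.E = Set.univ) (hM : M.Loopless) {B U : Finset (Fin n)}
    (hB : M.Indep (B : Set (Fin n))) (hdep : ¬ M.Indep (U : Set (Fin n))) :
    ∑ i ∈ U, (-1 : K) ^ (U.filter (· ≤ i)).card * flagDet K M π B (U.erase i) = 0 := by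
  by_cases hall : ∀ i ∈ U, flagDet K M π B (U.erase i) = 0
  · exact Finset.sum_eq_zero fun i hi => by rw [hall i hi, mul_zero]
  push Not at hall
  obtain ⟨i, hi, hne⟩ := hall
  have hcard := card_eq_of_flagDet_ne_zero hne
  rw [Finset.card_erase_of_mem hi] at hcard
  have hpos := Finset.card_pos.2 ⟨i, hi⟩
  refine sum_flagDet_erase_of_subset hM (by omega) fun x hx => ?_
  have hsub : ((U.erase i : Finset (Fin n)) : Set (Fin n)) ⊆ M.closure B :=
    fun y hy => mem_closure_of_flagDet_ne_zero hne hy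
  by_cases hxi : x = i
  · subst hxi
    by_contra hxB
    apply hdep
    rw [← Finset.insert_erase hi, Finset.coe_insert,
      (indep_of_flagDet_ne_zero hB hne).insert_indep_iff]
    exact Or.inl ⟨by simp [hE], fun h => hxB (M.closure_subset_closure_of_subset_closure hsub h)⟩
  · exact hsub (Finset.mem_coe.2 (Finset.mem_erase.2 ⟨hxi, hx⟩))

variable {β : Fin n → Fin n → Kˣ} {χ : Finset (Fin n) → K}
  {lt : Finset (Fin n) → Finset (Fin n) → Prop}

/-- The functional dual to `e_B` among the monomials without broken circuits. -/
def flagFunctional (M : Matroid (Fin n)) (β : Fin n → Fin n → Kˣ) (χ : Finset (Fin n) → K)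
    (π : Equiv.Perm (Fin n)) (B : Finset (Fin n)) : Alg β →ₗ[K] K :=
  (monBasis β).constr K fun X => (χ X)⁻¹ * flagDet K M π B X

theorem flagFunctional_mon (B X : Finset (Fin n)) :
    flagFunctional M β χ π B (mon β X) = (χ X)⁻¹ * flagDet K M π B X := by
  rw [← monBasis_apply, flagFunctional, Module.Basis.constr_basis]

/-- Here `χ X = 0`, and the convention `0⁻¹ = 0` does the work. -/
theorem flagFunctional_mon_of_not_indep (hχ : IsChi M β χ) {B X : Finset (Fin n)}
    (hX : ¬ M.Indep (X : Set (Fin n))) : flagFunctional M β χ π B (mon β X) = 0 := by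
  have : χ X = 0 := not_not.1 fun h => hX ((hχ.ne_zero_iff X).1 h)
  rw [flagFunctional_mon, this, inv_zero, zero_mul]

theorem flagFunctional_boundary (hE : M.E = Set.univ) (hM : M.Loopless) (hχ : IsChi M β χ)
    {B U : Finset (Fin n)} (hB : M.Indep (B : Set (Fin n)))
    (hU : ¬ M.Indep (U : Set (Fin n))) :
    flagFunctional M β χ π B (boundary β χ U) = 0 := by
  rw [boundary_of_not_indep hE hM hU, map_sum, ← sum_flagDet_erase (K := K) (π := π) hE hM hB hU]
  refine Finset.sum_congr rfl fun i _ => ?_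
  rw [map_smul, flagFunctional_mon, smul_eq_mul]
  by_cases h : flagDet K M π B (U.erase i) = 0
  · simp [h]
  · have := (hχ.ne_zero_iff _).2 (indep_of_flagDet_ne_zero hB h)
    field_simp

/-- If `C` and `Z` are disjoint and some `(C ∖ i) ∪ Z` is independent, then `C ∪ Z` is unidependent
and the product is a unit multiple of `∂e_{C ∪ Z}`. In all other cases each term is zero or a
multiple of a dependent monomial. -/
theorem flagFunctional_boundary_mul_mon (hE : M.E = Set.univ) (hM : M.Loopless)
    (hχ : IsChi M β χ) {B C : Finset (Fin n)} (hB : M.Indep (B : Set (Fin n)))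
    (hC : M.IsCircuit (C : Set (Fin n))) (Z : Finset (Fin n)) :
    flagFunctional M β χ π B (boundary β χ C * mon β Z) = 0 := by
  by_cases hcase : Disjoint C Z ∧
      ∃ i ∈ C, M.Indep ((C.erase i ∪ Z : Finset (Fin n)) : Set (Fin n))
  · obtain ⟨hd, i, hi, hind⟩ := hcase
    obtain ⟨ε, hε⟩ := hχ.boundary_eq (C ∪ Z) C (unidependent_of_indep_erase_union hC hi hind)
      (unidependent_of_isCircuit hC) Finset.subset_union_left
    rw [Finset.union_sdiff_cancel_left hd] at hε
    have h0 := flagFunctional_boundary (π := π) hE hM hχ hB (U := C ∪ Z) fun h =>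
      hC.not_indep (h.subset (Finset.coe_subset.2 Finset.subset_union_left))
    rw [hε, map_smul, smul_eq_mul] at h0
    exact (mul_eq_zero.1 h0).resolve_left ε.ne_zero
  · rw [boundary_of_not_indep hE hM hC.not_indep, Finset.sum_mul, map_sum]
    refine Finset.sum_eq_zero fun i hi => ?_
    rw [smul_mul_assoc, map_smul]
    by_cases hd : Disjoint (C.erase i) Z
    · obtain ⟨c, -, hc⟩ := mon_mul_mon_of_disjoint (β := β) hd
      rw [hc, map_smul, flagFunctional_mon_of_not_indep hχ, smul_zero, smul_zero]
      intro hind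
      refine hcase ⟨?_, i, hi, hind⟩
      by_contra hdC
      have hiZ : i ∈ Z := by
        by_contra hiZ
        refine hdC ?_
        rw [← Finset.insert_erase hi]
        exact Finset.disjoint_insert_left.2 ⟨hiZ, hd⟩
      refine hC.not_indep (hind.subset (Finset.coe_subset.2 fun x hx => ?_))
      by_cases hxi : x = i
      · exact Finset.mem_union_right _ (hxi ▸ hiZ)
      · exact Finset.mem_union_left _ (Finset.mem_erase.2 ⟨hxi, hx⟩)
    · rw [mon_mul_mon_of_not_disjoint hd, map_zero, smul_zero]

theorem flagFunctional_eq_zero_of_mem_chiIdeal (hE : M.E = Set.univ) (hM : M.Loopless)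
    (hχ : IsChi M β χ) {B : Finset (Fin n)} (hB : M.Indep (B : Set (Fin n))) {f : Alg β}
    (hf : f ∈ chiIdeal M β χ) : flagFunctional M β χ π B f = 0 := by
  -- The factor `h` makes the claim stable under the right action in the span induction.
  suffices ∀ h : Alg β, flagFunctional M β χ π B (f * h) = 0 by simpa using this 1
  induction hf using Submodule.span_induction with
  | mem f hf =>
    intro h
    rcases hf with ⟨C, hC, -, rfl⟩ | ⟨i, hi, -⟩
    · rw [← sum_coeff h, Finset.mul_sum, map_sum]
      refine Finset.sum_eq_zero fun Z _ => ?_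
      rw [mul_smul_comm, map_smul, flagFunctional_boundary_mul_mon hE hM hχ hB hC, smul_zero]
    · refine absurd ?_ hi.not_indep
      rw [Matroid.indep_singleton]
      exact Matroid.isNonloop_of_loopless (by simp [hE])
  | zero => simp
  | add x y _ _ hx hy =>
    intro h
    rw [add_mul, map_add, hx, hy, add_zero]
  | smul a x _ hx =>
    intro h
    have := hx (a.unop * h)
    rwa [← mul_assoc] at this

theorem flagFunctional_indProj (hχ : IsChi M β χ) (B : Finset (Fin n)) (f : Alg β) :
    flagFunctional M β χ π B (indProj M β f) = flagFunctional M β χ π B f := by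
  suffices (flagFunctional M β χ π B).comp (indProj M β) = flagFunctional M β χ π B from
    LinearMap.congr_fun this f
  refine (monBasis β).ext fun X => ?_
  rw [LinearMap.comp_apply, indProj, Module.Basis.constr_basis, monBasis_apply]
  split_ifs with h
  · rfl
  · rw [map_zero, flagFunctional_mon_of_not_indep hχ h]

/-- A nonzero determinant makes `Y` a transversal of the levels, and for nbc `B` the representative
of level `b` is `≥_π b`. Thus `Y` is the image of `B` under an injection that moves elements up. -/
theorem lt_of_flagDet_ne_zero (hlt : IsTermOrder lt) (hπ : Compatible lt π)
    {B Y : Finset (Fin n)} (hB : IsNbc M π B) (h : flagDet K M π B Y ≠ 0) :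
    B = Y ∨ lt B Y := by
  choose! σ hσY hσ using exists_isLevel_of_flagDet_ne_zero h
  have hinj : Set.InjOn σ B := by
    intro b hb b' hb' heq
    have h' := hσ b' hb'
    rw [← heq] at h'
    exact (hσ b hb).unique h'
  have himg : B.image σ = Y := by
    refine Finset.eq_of_subset_of_card_le (Finset.image_subset_iff.2 hσY) ?_
    rw [Finset.card_image_of_injOn hinj, card_eq_of_flagDet_ne_zero h]
  have := hlt.image hπ B hinj fun b hb => hB.le_of_isLevel (hσ b hb)
  rwa [himg] at this

/-- The other terms of `f` are smaller than `e_B`, while the functional sees nothing below `e_B`;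
only the leading term contributes. -/
theorem flagFunctional_ne_zero_of_isLeading (hE : M.E = Set.univ) (hχ : IsChi M β χ)
    (hlt : IsTermOrder lt) (hπ : Compatible lt π) {B : Finset (Fin n)} (hB : IsNbc M π B)
    {f : Alg β} (hf : IsLeading lt f B) : flagFunctional M β χ π B f ≠ 0 := by
  have hBi := hB.indep hE
  rw [← sum_coeff f, map_sum, Finset.sum_eq_single B]
  · rw [map_smul, flagFunctional_mon, flagDet_self hE hBi, mul_one, smul_eq_mul]
    exact mul_ne_zero hf.1 (inv_ne_zero ((hχ.ne_zero_iff B).2 hBi))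
  · intro Y _ hYB
    rw [map_smul, flagFunctional_mon]
    by_cases hY : coeff β f Y = 0
    · rw [hY, zero_smul]
    by_cases hd : flagDet K M π B Y = 0
    · rw [hd, mul_zero, smul_zero]
    have h1 := (lt_of_flagDet_ne_zero hlt hπ hB hd).resolve_left (Ne.symm hYB)
    exact absurd (hlt.trans _ _ _ h1 (hf.2 Y hY hYB)) (hlt.irrefl _)
  · simp

/-- The leading monomial of an element killed by all flag functionals contains the broken part of
a circuit in `ℭ_π`. -/
theorem exists_piCircuit_of_isLeading (hE : M.E = Set.univ) (hχ : IsChi M β χ)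
    (hlt : IsTermOrder lt) (hπ : Compatible lt π) {f : Alg β} {X : Finset (Fin n)}
    (hf : IsLeading lt f X)
    (h0 : ∀ B : Finset (Fin n), M.Indep (B : Set (Fin n)) → flagFunctional M β χ π B f = 0) :
    ∃ C ∈ piCircuits M π, ∃ a, IsPiLeast π C a ∧ C.erase a ⊆ X := by
  by_contra! h
  have hX : IsNbc M π X := isNbc_of_piCircuits hE h
  exact flagFunctional_ne_zero_of_isLeading hE hχ hlt hπ hX hf (h0 X (hX.indep hE))

end Functional

/-! ### The Gröbner bases of both ideals. -/

section Groebner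

variable {K : Type*} [Field K] {n : ℕ} {M : Matroid (Fin n)} {π : Equiv.Perm (Fin n)}
  {β : Fin n → Fin n → Kˣ} {χ : Finset (Fin n) → K}
  {lt : Finset (Fin n) → Finset (Fin n) → Prop}

theorem boundary_ne_zero (hE : M.E = Set.univ) (hM : M.Loopless) (hχ : IsChi M β χ)
    {C : Finset (Fin n)} (hC : M.IsCircuit (C : Set (Fin n))) : boundary β χ C ≠ 0 := by
  intro h
  obtain ⟨i, hi⟩ := hC.nonempty
  exact coeff_boundary_erase_ne_zero hE hM hχ hC hi (by rw [h, coeff_zero])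

theorem isGroebner_boundaryFamily (hE : M.E = Set.univ) (hM : M.Loopless) (hχ : IsChi M β χ)
    (hlt : IsTermOrder lt) (hπ : Compatible lt π) :
    IsGroebner lt (chiIdeal M β χ : Set (Alg β)) (boundaryFamily M β χ π) where
  subset := by
    rintro f ⟨C, hC, rfl⟩
    exact boundary_mem_chiIdeal hE hM (isCircuit_of_mem_piCircuits hC)
  ne_zero := by
    rintro f ⟨C, hC, rfl⟩
    exact boundary_ne_zero hE hM hχ (isCircuit_of_mem_piCircuits hC)
  lt_eq := by
    refine le_antisymm (Submodule.span_mono (leadingMons_mono ?_)) (Submodule.span_le.2 ?_)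
    · rintro f ⟨C, hC, rfl⟩
      exact boundary_mem_chiIdeal hE hM (isCircuit_of_mem_piCircuits hC)
    · rintro m ⟨f, hf, X, hX, rfl⟩
      obtain ⟨C, hC, a, ha, hsub⟩ := exists_piCircuit_of_isLeading hE hχ hlt hπ hX fun B hB =>
        flagFunctional_eq_zero_of_mem_chiIdeal hE hM hχ hB hf
      exact mon_mem_ltIdeal ⟨C, hC, rfl⟩
        (isLeading_boundary hE hM hχ hlt hπ (isCircuit_of_mem_piCircuits hC) ha) hsub

theorem indIdealSpan_mono {S T : Set (Alg β)} (h : S ⊆ T) :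
    indIdealSpan M S ≤ indIdealSpan M T :=
  sInf_le_sInf fun _ hN => ⟨h.trans hN.1, hN.2⟩

theorem isIndGroebner_boundaryFamily (hE : M.E = Set.univ) (hM : M.Loopless)
    (hχ : IsChi M β χ) (hlt : IsTermOrder lt) (hπ : Compatible lt π) :
    IsIndGroebner M lt (indProj M β '' (chiIdeal M β χ : Set (Alg β)))
      (boundaryFamily M β χ π) := by
  have hsub : boundaryFamily M β χ π ⊆ indProj M β '' (chiIdeal M β χ : Set (Alg β)) := by
    rintro f ⟨C, hC, rfl⟩
    have hC := isCircuit_of_mem_piCircuits hC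
    exact ⟨_, boundary_mem_chiIdeal hE hM hC, indProj_boundary hE hM hC⟩
  refine ⟨hsub, (isGroebner_boundaryFamily hE hM hχ hlt hπ).ne_zero, le_antisymm
    (indIdealSpan_mono (leadingMons_mono hsub)) (le_sInf ?_)⟩
  rintro N ⟨hSN, hN⟩
  refine sInf_le ⟨?_, hN⟩
  rintro m ⟨_, ⟨f, hf, rfl⟩, X, hX, rfl⟩
  have hXi : M.Indep (X : Set (Fin n)) := by
    classical
    by_contra h
    exact hX.1 (by rw [coeff_indProj, if_neg h])
  obtain ⟨C, hC, a, ha, hCX⟩ := exists_piCircuit_of_isLeading hE hχ hlt hπ hX fun B hB => by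
    rw [flagFunctional_indProj hχ, flagFunctional_eq_zero_of_mem_chiIdeal hE hM hχ hB hf]
  obtain ⟨c, hc⟩ := exists_mon_eq_mul (β := β) hCX
  have hlead := isLeading_boundary (lt := lt) hE hM hχ hlt hπ (isCircuit_of_mem_piCircuits hC) ha
  -- The cofactor lies in `K[𝕋_i]` because `X` is independent, being a term of a projected element.
  have := hN _ (hSN ⟨_, ⟨C, hC, rfl⟩, _, hlead, rfl⟩) (c • mon β (X \ C.erase a))
    (Submodule.smul_mem _ _ (Submodule.subset_span ⟨_, hXi.subset (by simp), rfl⟩))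
  rwa [star, ← hc, indProj_mon hXi] at this

theorem exists_of_mem_normalize (hE : M.E = Set.univ) (hM : M.Loopless)
    (hχ : IsChi M β χ) (hlt : IsTermOrder lt) (hπ : Compatible lt π) {g : Alg β}
    (hg : g ∈ normalize lt (boundaryFamily M β χ π)) :
    ∃ C ∈ piCircuits M π, ∃ a, IsPiLeast π C a ∧
      IsLeading lt (boundary β χ C) (C.erase a) ∧
      g = (coeff β (boundary β χ C) (C.erase a))⁻¹ • boundary β χ C := by
  obtain ⟨f, ⟨C, hC, rfl⟩, X, hX, rfl⟩ := hg
  have hC' := isCircuit_of_mem_piCircuits hC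
  obtain ⟨a, ha⟩ := exists_isPiLeast π hC'.nonempty
  have hlead := isLeading_boundary (lt := lt) hE hM hχ hlt hπ hC' ha
  obtain rfl := hX.unique hlt hlead
  exact ⟨C, hC, a, ha, hlead, rfl⟩

theorem coeff_of_mem_normalize (hlt : IsTermOrder lt) {S : Set (Alg β)} {g : Alg β}
    (hg : g ∈ normalize lt S) {X : Finset (Fin n)} (hX : IsLeading lt g X) :
    coeff β g X = 1 := by
  obtain ⟨f, -, Y, hY, rfl⟩ := hg
  obtain rfl := hY.unique hlt ((isLeading_smul_iff (inv_ne_zero hY.1)).1 hX)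
  rw [coeff_smul, inv_mul_cancel₀ hY.1]

theorem not_subset_of_mem_normalize (hE : M.E = Set.univ) (hM : M.Loopless)
    (hχ : IsChi M β χ) (hlt : IsTermOrder lt) (hπ : Compatible lt π) {g g' : Alg β}
    (hg : g ∈ normalize lt (boundaryFamily M β χ π))
    (hg' : g' ∈ normalize lt (boundaryFamily M β χ π)) (hne : g ≠ g') {X Y : Finset (Fin n)}
    (hX : IsLeading lt g X) (hY : coeff β g' Y ≠ 0) : ¬ X ⊆ Y := by
  intro hXY
  obtain ⟨C, hC, a, ha, hl, rfl⟩ := exists_of_mem_normalize hE hM hχ hlt hπ hg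
  obtain ⟨C', hC', a', ha', hl', rfl⟩ := exists_of_mem_normalize hE hM hχ hlt hπ hg'
  obtain rfl := ((isLeading_smul_iff (inv_ne_zero hl.1)).1 hX).unique hlt hl
  rw [coeff_smul] at hY
  obtain ⟨i, -, rfl⟩ := exists_of_coeff_boundary_ne_zero hE hM (isCircuit_of_mem_piCircuits hC')
    (right_ne_zero_of_mul hY)
  obtain rfl := eq_of_erase_subset_erase hC hC' ha hXY
  obtain rfl := ha.unique ha'
  exact hne rfl

theorem isReducedGroebner_normalize (hE : M.E = Set.univ) (hM : M.Loopless) (hχ : IsChi M β χ)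
    (hlt : IsTermOrder lt) (hπ : Compatible lt π) :
    IsReducedGroebner lt (chiIdeal M β χ : Set (Alg β))
      (normalize lt (boundaryFamily M β χ π)) where
  subset := by
    rintro g ⟨f, hf, X, hX, rfl⟩
    have h := (isGroebner_boundaryFamily hE hM hχ hlt hπ).subset hf
    -- The ideal carries only the right action of the algebra; scalars act through it because they
    -- are central.
    have := (chiIdeal M β χ).smul_mem
      (MulOpposite.op (algebraMap K (Alg β) (coeff β f X)⁻¹)) h
    rwa [op_smul_eq_mul, ← Algebra.commutes, ← Algebra.smul_def] at this
  ne_zero := by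
    rintro g ⟨f, hf, X, hX, rfl⟩
    exact ((isLeading_smul_iff (inv_ne_zero hX.1)).2 hX).ne_zero
  lt_eq := by
    rw [← (isGroebner_boundaryFamily hE hM hχ hlt hπ).lt_eq, ltIdeal,
      leadingMons_normalize, ltIdeal]
  monic := fun g hg X hX => coeff_of_mem_normalize hlt hg hX
  reduced := by
    rintro g hg g' hg' hne X Y hX hY ⟨h, hh⟩
    refine not_subset_of_mem_normalize hE hM hχ hlt hπ hg hg' hne hX hY ?_
    refine subset_of_coeff_mon_mul_ne_zero (β := β) (f := h) ?_
    rw [← hh, coeff_smul, coeff_mon, if_pos rfl, mul_one]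
    exact hY

theorem isReducedIndGroebner_normalize (hE : M.E = Set.univ) (hM : M.Loopless)
    (hχ : IsChi M β χ) (hlt : IsTermOrder lt) (hπ : Compatible lt π) :
    IsReducedIndGroebner M lt (indProj M β '' (chiIdeal M β χ : Set (Alg β)))
      (normalize lt (boundaryFamily M β χ π)) where
  subset := by
    rintro g ⟨f, hf, X, hX, rfl⟩
    have hg := (isReducedGroebner_normalize hE hM hχ hlt hπ).subset ⟨f, hf, X, hX, rfl⟩
    obtain ⟨C, hC, rfl⟩ := hf
    exact ⟨_, hg, by rw [map_smul, indProj_boundary hE hM (isCircuit_of_mem_piCircuits hC)]⟩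
  ne_zero := (isReducedGroebner_normalize hE hM hχ hlt hπ).ne_zero
  lt_eq := by
    rw [← (isIndGroebner_boundaryFamily hE hM hχ hlt hπ).lt_eq, leadingMons_normalize]
  monic := fun g hg X hX => coeff_of_mem_normalize hlt hg hX
  reduced := by
    classical
    rintro g hg g' hg' hne X Y hX hY ⟨h, -, hh⟩
    refine not_subset_of_mem_normalize hE hM hχ hlt hπ hg hg' hne hX hY ?_
    refine subset_of_coeff_mon_mul_ne_zero (β := β) (f := h) fun h0 => hY ?_
    have := congrArg (fun f => coeff β f Y) hh
    simp only [star, coeff_indProj, h0, ite_self, coeff_smul, coeff_mon, if_pos, mul_one] at this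
    exact this

end Groebner

end ChiAlg

end

theorem theorem3 {K : Type*} [Field K] {n : ℕ} (M : Matroid (Fin n)) (hE : M.E = Set.univ)
    (hM : M.Loopless) (β : Fin n → Fin n → Kˣ) (χ : Finset (Fin n) → K)
    (hχ : ChiAlg.IsChi M β χ)
    (lt : Finset (Fin n) → Finset (Fin n) → Prop) (hlt : ChiAlg.IsTermOrder lt)
    (π : Equiv.Perm (Fin n)) (hπ : ChiAlg.Compatible lt π) :
    -- the boundaries form a Gröbner basis of the ideal of the whole algebra
    ChiAlg.IsGroebner lt (ChiAlg.chiIdeal M β χ : Set (ChiAlg.Alg β))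
      (ChiAlg.boundaryFamily M β χ π) ∧
    -- made monic, they form the (unique) reduced Gröbner basis of this ideal
    ChiAlg.IsReducedGroebner lt (ChiAlg.chiIdeal M β χ : Set (ChiAlg.Alg β))
      (ChiAlg.normalize lt (ChiAlg.boundaryFamily M β χ π)) ∧
    (∀ G : Set (ChiAlg.Alg β),
      ChiAlg.IsReducedGroebner lt (ChiAlg.chiIdeal M β χ : Set (ChiAlg.Alg β)) G →
      G = ChiAlg.normalize lt (ChiAlg.boundaryFamily M β χ π)) ∧
    -- the same for the projected ideal of the algebra on the independent monomials
    ChiAlg.IsIndGroebner M lt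
      (ChiAlg.indProj M β '' (ChiAlg.chiIdeal M β χ : Set (ChiAlg.Alg β)))
      (ChiAlg.boundaryFamily M β χ π) ∧
    ChiAlg.IsReducedIndGroebner M lt
      (ChiAlg.indProj M β '' (ChiAlg.chiIdeal M β χ : Set (ChiAlg.Alg β)))
      (ChiAlg.normalize lt (ChiAlg.boundaryFamily M β χ π)) := by
  exact ⟨ChiAlg.isGroebner_boundaryFamily hE hM hχ hlt hπ,
    ChiAlg.isReducedGroebner_normalize hE hM hχ hlt hπ,
    fun _ hG => hG.unique hlt (ChiAlg.isReducedGroebner_normalize hE hM hχ hlt hπ),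
    ChiAlg.isIndGroebner_boundaryFamily hE hM hχ hlt hπ,
    ChiAlg.isReducedIndGroebner_normalize hE hM hχ hlt hπ⟩
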